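/- Let $k\ge 3$ be a fixed integer. For $j\ge 0$ put $f_j(x)=e^x-\sum_{i=0}^{j-1}x^i/i!$, and put $h_k(x)=x e^x/f_{k-1}(x)$ for $x>0$. Let $c_k=\inf\{h_k(x):x>0\}$, let $\mu_k>0$ be the (unique) positive number with $h_k(\mu_k)=c_k$, and let $$c_k'=\frac{\mu_k\, f_{k-1}(\mu_k)}{f_k(\mu_k)}.$$ Given $n,m$ with $2m\ge kn$, let $a$ be chosen uniformly at random among the functions $a:\{1,\dots,2m\}\to\{1,\dots,n\}$ with $|a^{-1}(v)|\ge k$ for every $v$, and let $G_m(k,n,m)$ be the random multigraph with vertex set $\{1,\dots,n\}$ and $m$ edges, the $i$-th of which joins $a(i)$ and $a(m+i)$ (loops and parallel edges are allowed; a loop adds $2$ to the degree of its vertex). The $k$-core $K(H)$ of a multigraph $H$ is its maximal subgraph with minimum degree at least $k$ (possibly empty). Let $W(H)=|V(H)|-|V(K(H-e))|$, where $e$ is an edge of $H$ chosen uniformly at random among all edges of $H$, counted with multiplicity. Let $m=m(n)$ be a sequence of nonnegative integers, let $C_0$ be a real constant, and let $\psi(n)$ be real numbers, positive for all sufficiently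 large $n$, with $\psi(n)=\omega(n^{-1/4})$ as $n\to\infty$, such that $c=2m/n$ satisfies $c_k'+\psi(n)\le c\le C_0$ for all sufficiently large $n$. Then for every real function $h(n)$, positive for all sufficiently large $n$, with $h(n)=\omega(1/\psi(n))$, $$\mathbb P\bigl(W(G_m(k,n,m))\ge h(n)\bigr)\to 0\qquad (n\to\infty).$$ Here $u(n)=\omega(v(n))$ means $v(n)=o(u(n))$. -/

import Mathlib

open Filter Topology Asymptotics MeasureTheory ProbabilityTheory

namespace KCore

/-! ### Multigraphs and their k-cores -/

/-- The degree of a vertex of a multigraph: every incident edge counts once and every loop counts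
once more, so that a loop contributes two. -/
noncomputable def degree {α β : Type*} (G : Graph α β) (v : α) : ℕ∞ :=
  (G.incidenceSet v).encard + (G.loopSet v).encard

/-- All degrees of `G` are at least `k`. -/
def MinDegreeGE {α β : Type*} (k : ℕ) (G : Graph α β) : Prop :=
  ∀ v ∈ G.vertexSet, (k : ℕ∞) ≤ degree G v

/-- The `k`-core of `G`: the subgraph induced by all vertices that lie in some subgraph of `G`
with minimum degree at least `k`. It is the maximal such subgraph, see `isGreatest_kCore`. -/
def kCore {α β : Type*} (k : ℕ) (G : Graph α β) : Graph α β :=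
  G.induce {v | ∃ H : Graph α β, H ≤ G ∧ MinDegreeGE k H ∧ v ∈ H.vertexSet}

theorem degree_mono {α β : Type*} {H G : Graph α β} (h : H ≤ G) (v : α) :
    degree H v ≤ degree G v := by
  unfold degree
  refine add_le_add (Set.encard_le_encard ?_) (Set.encard_le_encard ?_)
  · intro e he
    exact Graph.Inc.mono h he
  · intro e he
    exact Graph.IsLoopAt.mono h he

theorem isGreatest_kCore {α β : Type*} (k : ℕ) (G : Graph α β) :
    IsGreatest {H : Graph α β | H ≤ G ∧ MinDegreeGE k H} (kCore k G) := by
  have key : ∀ H : Graph α β, H ≤ G → MinDegreeGE k H → H ≤ kCore k G := by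
    intro H hH hk
    refine ⟨fun v hv => ⟨H, hH, hk, hv⟩, fun e x y hxy => ?_⟩
    exact ⟨hxy.mono hH, ⟨H, hH, hk, hxy.left_mem⟩, ⟨H, hH, hk, hxy.right_mem⟩⟩
  refine ⟨⟨Graph.induce_le ?_, ?_⟩, fun H hH => key H hH.1 hH.2⟩
  · rintro v ⟨H, hH, -, hv⟩
    exact hH.vertexSet_mono hv
  · rintro v ⟨H, hH, hk, hv⟩
    exact (hk v hv).trans (degree_mono (key H hH hk) v)

/-- The number of vertices of `G` that are lost when the edge `e` is deleted from `G` and the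
`k`-core of the remaining multigraph is taken. -/
noncomputable def lostVertices {α β : Type*} (k : ℕ) (G : Graph α β) (e : β) : ℕ :=
  G.vertexSet.ncard - (kCore k (G.deleteEdges {e})).vertexSet.ncard

/-! ### The allocation model -/

/-- The allocations of `2m` points to `n` bins in which every bin receives at least `k` points. -/
def allocations (k n m : ℕ) : Set (Fin (2 * m) → Fin n) :=
  {a | ∀ v : Fin n, k ≤ {i : Fin (2 * m) | a i = v}.ncard}

/-- The multigraph of an allocation `a`: its vertices are the `n` bins and its edges are indexed
by `i < m`, where the edge `i` joins `a i` and `a (m + i)`. -/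
def allocationGraph {n m : ℕ} (a : Fin (2 * m) → Fin n) : Graph (Fin n) (Fin m) where
  vertexSet := Set.univ
  edgeSet := Set.univ
  IsLink i x y := s(x, y) = s(a ⟨i, by omega⟩, a ⟨m + i, by omega⟩)
  isLink_symm i _ := { symm := fun x y h => by rw [Sym2.eq_swap]; exact h }
  eq_or_eq_of_isLink_of_isLink i x y v w h h' := by
    rw [← h', Sym2.eq_iff] at h
    tauto
  edge_mem_iff_exists_isLink i := ⟨fun _ => ⟨_, _, rfl⟩, fun _ => Set.mem_univ i⟩
  left_mem_of_isLink := by simp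

/-- The joint law of a uniformly random allocation with all bins of size at least `k` and of an
independent uniformly random edge index, that is, of the random multigraph `G_m(k, n, m)` together
with one of its `m` edges chosen uniformly at random. -/
noncomputable def allocationLaw (k n m : ℕ) : Measure ((Fin (2 * m) → Fin n) × Fin m) :=
  (uniformOn (allocations k n m)).prod (uniformOn Set.univ)

/-! ### The critical average degree -/

/-- `f_k(x) = e^x - ∑_{i<k} x^i / i!`. -/
noncomputable def expTail (k : ℕ) (x : ℝ) : ℝ :=
  Real.exp x - ∑ i ∈ Finset.range k, x ^ i / (i.factorial : ℝ)

/-- `h_k(x) = x e^x / f_{k-1}(x)`. -/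
noncomputable def coreFun (k : ℕ) (x : ℝ) : ℝ :=
  Real.exp x * x / expTail (k - 1) x

/-- `c_k = inf {h_k(x) : x > 0}`. -/
noncomputable def coreThreshold (k : ℕ) : ℝ :=
  sInf (coreFun k '' Set.Ioi 0)

/-- `μ_{k,c_k}`: the (largest) positive root of `h_k(x) = c_k`. For `k ≥ 3` there is exactly
one positive root, see `existsUnique_critical` and `criticalPoint_spec`. -/
noncomputable def criticalPoint (k : ℕ) : ℝ :=
  sSup {x : ℝ | 0 < x ∧ coreFun k x = coreThreshold k}

/-- `c_k' = μ f_{k-1}(μ) / f_k(μ)` at `μ = μ_{k,c_k}`. -/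
noncomputable def criticalDegree (k : ℕ) : ℝ :=
  criticalPoint k * expTail (k - 1) (criticalPoint k) / expTail k (criticalPoint k)

theorem hasSum_expTail (j : ℕ) (x : ℝ) :
    HasSum (fun i : ℕ => x ^ (i + j) / ((i + j).factorial : ℝ)) (expTail j x) := by
  have h : HasSum (fun i : ℕ => x ^ i / (i.factorial : ℝ)) (Real.exp x) := by
    rw [Real.exp_eq_exp_ℝ]
    exact NormedSpace.expSeries_div_hasSum_exp x
  exact (hasSum_nat_add_iff' j).2 h

theorem hasSum_expTail_div (j : ℕ) {x : ℝ} (hx : 0 < x) :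
    HasSum (fun i : ℕ => x ^ i / ((i + j).factorial : ℝ)) (expTail j x / x ^ j) := by
  have h := (hasSum_expTail j x).div_const (x ^ j)
  refine h.congr_fun ?_
  intro i
  have : x ^ j ≠ 0 := by positivity
  rw [pow_add]
  field_simp

theorem expTail_pos (j : ℕ) {x : ℝ} (hx : 0 < x) : 0 < expTail j x := by
  have h := hasSum_expTail j x
  rw [← h.tsum_eq]
  exact h.summable.tsum_pos (fun i => by positivity) 0 (by positivity)

theorem expTail_div_lt (j : ℕ) {x y : ℝ} (hx : 0 < x) (hxy : x < y) :
    expTail j x / x ^ j < expTail j y / y ^ j := by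
  refine hasSum_lt (i := 1) (fun i => ?_) ?_ (hasSum_expTail_div j hx)
    (hasSum_expTail_div j (hx.trans hxy))
  · gcongr
  · simp only [pow_one]
    gcongr

theorem expTail_succ (j : ℕ) (x : ℝ) :
    expTail j x = expTail (j + 1) x + x ^ j / (j.factorial : ℝ) := by
  unfold expTail
  rw [Finset.sum_range_succ]
  ring

theorem hasDerivAt_expTail_succ (j : ℕ) (x : ℝ) :
    HasDerivAt (expTail (j + 1)) (expTail j x) x := by
  induction j with
  | zero =>
    have e0 : expTail (0 + 1) = fun y => Real.exp y - 1 := by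
      funext y
      simp [expTail]
    have e1 : expTail 0 x = Real.exp x := by simp [expTail]
    rw [e0, e1]
    exact (Real.hasDerivAt_exp x).sub_const 1
  | succ j ih =>
    have h2 : HasDerivAt (fun x : ℝ => x ^ (j + 1) / ((j + 1).factorial : ℝ))
        (x ^ j / (j.factorial : ℝ)) x := by
      have := (hasDerivAt_pow (j + 1) x).div_const ((j + 1).factorial : ℝ)
      refine this.congr_deriv ?_
      rw [Nat.factorial_succ]
      push_cast
      have : (j.factorial : ℝ) ≠ 0 := by positivity
      field_simp
    have h3 := ih.sub h2
    have e1 : expTail (j + 1 + 1) = fun x => expTail (j + 1) x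
        - x ^ (j + 1) / ((j + 1).factorial : ℝ) := by
      funext y
      rw [expTail_succ (j + 1) y]
      ring
    rw [e1]
    refine h3.congr_deriv ?_
    rw [expTail_succ j x]
    ring

theorem expTail_le_exp (j : ℕ) {x : ℝ} (hx : 0 < x) : expTail j x ≤ Real.exp x := by
  unfold expTail
  have : 0 ≤ ∑ i ∈ Finset.range j, x ^ i / (i.factorial : ℝ) :=
    Finset.sum_nonneg fun i _ => by positivity
  linarith

theorem expTail_two_le {j : ℕ} (hj : 2 ≤ j) {x : ℝ} (hx : 0 < x) :
    expTail j x ≤ x ^ 2 * Real.exp x := by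
  have h1 : expTail j x ≤ expTail 2 x := by
    induction j, hj using Nat.le_induction with
    | base => exact le_rfl
    | succ j hj ih =>
      have := expTail_succ j x
      have : 0 < x ^ j / (j.factorial : ℝ) := by positivity
      linarith
  have h0 := hasSum_expTail 0 x
  have h2 := hasSum_expTail_div 2 hx
  have h3 : expTail 2 x / x ^ 2 ≤ expTail 0 x := by
    refine hasSum_le (fun i => ?_) h2 h0
    simp only [add_zero]
    gcongr
    omega
  have h4 : expTail 0 x = Real.exp x := by simp [expTail]
  rw [h4, div_le_iff₀ (by positivity)] at h3
  linarith

theorem le_coreFun (k : ℕ) {x : ℝ} (hx : 0 < x) : x ≤ coreFun k x := by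
  unfold coreFun
  rw [le_div_iff₀ (expTail_pos _ hx)]
  nlinarith [expTail_le_exp (k - 1) hx]

theorem inv_le_coreFun {k : ℕ} (hk : 3 ≤ k) {x : ℝ} (hx : 0 < x) : x⁻¹ ≤ coreFun k x := by
  unfold coreFun
  rw [le_div_iff₀ (expTail_pos _ hx), inv_mul_le_iff₀ hx]
  have := expTail_two_le (j := k - 1) (by omega) hx
  nlinarith

theorem hasDerivAt_coreFun {k : ℕ} (hk : 3 ≤ k) {x : ℝ} (hx : 0 < x) :
    HasDerivAt (coreFun k)
      (((Real.exp x * x + Real.exp x * 1) * expTail (k - 1) x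
        - Real.exp x * x * expTail (k - 2) x) / expTail (k - 1) x ^ 2) x := by
  obtain ⟨j, rfl⟩ : ∃ j, k = j + 2 := ⟨k - 2, by omega⟩
  exact ((Real.hasDerivAt_exp x).mul (hasDerivAt_id x)).div (hasDerivAt_expTail_succ j x)
    (expTail_pos _ hx).ne'

theorem existsUnique_critical {k : ℕ} (hk : 3 ≤ k) :
    ∃! x : ℝ, 0 < x ∧ coreFun k x = coreThreshold k := by
  obtain ⟨j, rfl⟩ : ∃ j, k = j + 2 := ⟨k - 2, by omega⟩
  have hbdd : BddBelow (coreFun (j + 2) '' Set.Ioi 0) := by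
    refine ⟨0, ?_⟩
    rintro _ ⟨x, hx, rfl⟩
    exact (le_of_lt hx).trans (le_coreFun _ hx)
  have hmin : ∀ x : ℝ, 0 < x → coreThreshold (j + 2) ≤ coreFun (j + 2) x := fun x hx =>
    csInf_le hbdd ⟨x, hx, rfl⟩
  refine existsUnique_of_exists_of_unique ?_ ?_
  · set A : ℝ := coreFun (j + 2) 1 with hA
    have hA1 : 1 ≤ A := le_coreFun _ one_pos
    have hcont : ContinuousOn (coreFun (j + 2)) (Set.Icc A⁻¹ A) := by
      intro x hx
      have : 0 < x := lt_of_lt_of_le (by positivity) hx.1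
      exact (hasDerivAt_coreFun hk this).continuousAt.continuousWithinAt
    have h1mem : (1 : ℝ) ∈ Set.Icc A⁻¹ A := ⟨inv_le_one_of_one_le₀ hA1, hA1⟩
    obtain ⟨x₀, hx₀, hx₀min⟩ := isCompact_Icc.exists_isMinOn ⟨1, h1mem⟩ hcont
    have hx₀pos : 0 < x₀ := lt_of_lt_of_le (by positivity) hx₀.1
    refine ⟨x₀, hx₀pos, le_antisymm ?_ (hmin x₀ hx₀pos)⟩
    refine le_csInf ⟨_, 1, Set.mem_Ioi.2 one_pos, rfl⟩ ?_
    rintro _ ⟨y, hy, rfl⟩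
    have hy : 0 < y := hy
    have h01 : coreFun (j + 2) x₀ ≤ A := hx₀min h1mem
    by_cases hyA : y ≤ A
    · by_cases hyA2 : A⁻¹ ≤ y
      · exact hx₀min ⟨hyA2, hyA⟩
      · push Not at hyA2
        have h2 : A < y⁻¹ := (lt_inv_comm₀ (by positivity) hy).2 hyA2
        exact h01.trans (h2.le.trans (inv_le_coreFun hk hy))
    · push Not at hyA
      exact h01.trans (hyA.le.trans (le_coreFun _ hy))
  · have hcrit : ∀ x : ℝ, 0 < x ∧ coreFun (j + 2) x = coreThreshold (j + 2) →
        expTail (j + 1) x / x ^ (j + 1) = 1 / (j.factorial : ℝ) := by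
      rintro x ⟨hx, hxc⟩
      have hloc : IsLocalMin (coreFun (j + 2)) x := by
        filter_upwards [lt_mem_nhds hx] with y hy
        rw [hxc]
        exact hmin y hy
      have hd := hloc.hasDerivAt_eq_zero (hasDerivAt_coreFun hk hx)
      have hpos := expTail_pos (j + 1) hx
      have hs := expTail_succ j x
      simp only [Nat.add_sub_cancel, show j + 2 - 1 = j + 1 by omega] at hd
      rw [div_eq_zero_iff] at hd
      rcases hd with hd | hd
      · rw [hs] at hd
        have hexp := Real.exp_pos x
        have h5 : Real.exp x * (expTail (j + 1) x - x * (x ^ j / (j.factorial : ℝ))) = 0 := by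
          linarith
        have h6 := (mul_eq_zero.1 h5).resolve_left hexp.ne'
        have h7 : expTail (j + 1) x = x ^ (j + 1) / (j.factorial : ℝ) := by
          rw [pow_succ, mul_comm (x ^ j) x, mul_div_assoc]
          linarith
        rw [h7]
        have : (j.factorial : ℝ) ≠ 0 := by positivity
        field_simp
      · exact absurd hd (by positivity)
    intro x y hx hy
    have ex := hcrit x hx
    have ey := hcrit y hy
    rcases lt_trichotomy x y with h | h | h
    · exact absurd (ex.trans ey.symm) (expTail_div_lt (j + 1) hx.1 h).ne
    · exact h
    · exact absurd (ey.trans ex.symm) (expTail_div_lt (j + 1) hy.1 h).ne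

theorem criticalPoint_spec {k : ℕ} (hk : 3 ≤ k) :
    0 < criticalPoint k ∧ coreFun k (criticalPoint k) = coreThreshold k := by
  obtain ⟨x, hx, hu⟩ := existsUnique_critical hk
  have : {x : ℝ | 0 < x ∧ coreFun k x = coreThreshold k} = {x} := by
    ext y
    exact ⟨fun h => hu y h, fun h => by rw [Set.mem_singleton_iff.1 h]; exact hx⟩
  have h : criticalPoint k = x := by
    unfold criticalPoint
    rw [this, csSup_singleton]
  rw [h]
  exact hx

end KCore

/-! Deleting an edge starts a pruning process on points. Its two points are queued; whenever a
removed point lies in a bin of exactly k remaining points, the whole bin goes and the partners of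
its other k - 1 points are queued. What survives avoids the edge and has minimum degree at least k,
so it lies in the core of what is left, and each step costs at most one vertex. Hence W is at most
the duration of the process (`lostVertices_le_pruneTime`).

The pairing is fixed and the allocation is random, so given the history the points still present are
exchangeable. The next point therefore lies in a bin of size k with probability equal to the mean
proportion of such points. If k - 1 times this proportion is at most 1 - δ, the queue has drift at
most -δ, the mean duration is at most 2/δ (`sum_pruneTime_le`), and Markov's inequality gives P(W ≥
h) ≤ 2/(δh).

To find δ, view the bin sizes as independent Poisson(x) variables conditioned to be at least k, with
x chosen so that their mean is c, and then conditioned on total 2m. With q the probability of size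
k, one has k(k-1)q/c = g(μ)/g(x), where g(y) = f_{k-1}(y)/y^{k-1} is increasing and g(μ) = 1/(k-2)!
is the first order condition for the minimum of h_k. As x - μ ≥ c - c_k', this ratio is at most 1 -
c₁(c - c_k') (`exists_subcritical`), so δ can be of order ψ.

It remains to see that the number of bins of size k exceeds qn by more than ηn only rarely, for η a
small multiple of ψ. For independent bins Chernoff's bound gives exp(-nη²/4); conditioning on the
total costs a factor of at most exp(C√n), by a crude local estimate
(`exists_exp_neg_sqrt_le_totalLaw`). The condition ψ = ω(n^{-1/4}) makes nη² dominate √n, and h =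
ω(1/ψ) makes 1/(δh) vanish. -/

namespace KCore

/-! ### The pruning process and its mean duration under exchangeability -/

section Exploration

variable {P V : Type*} [DecidableEq P] [DecidableEq V]

/-- The points of `U` that `a` puts into the same bin as `j`. -/
def binOf (a : P → V) (U : Finset P) (j : P) : Finset P :=
  U.filter fun i => a i = a j

/-- The points of `U` that lie in a bin containing exactly `k` points of `U`. -/
def minimalPoints (k : ℕ) (a : P → V) (U : Finset P) : Finset P :=
  U.filter fun i => (binOf a U i).card = k

open Classical in
/-- The number of steps, at most `N`, of the pruning process with present points `U` and with the
set `Q` of points waiting for deletion: each step deletes one point of `Q`, and if its bin held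
exactly `k` points, then the whole bin is deleted and the partners of its points join `Q`. -/
noncomputable def pruneTime (k : ℕ) (σ : P → P) (a : P → V) : ℕ → Finset P → Finset P → ℕ
  | 0, _, _ => 0
  | N + 1, U, Q =>
    if h : Q.Nonempty then
      1 + if h.choose ∈ U then
        if (binOf a U h.choose).card = k then
          pruneTime k σ a N (U \ binOf a U h.choose)
            (Q.erase h.choose ∪ ((binOf a U h.choose).erase h.choose).image σ)
        else pruneTime k σ a N (U.erase h.choose) (Q.erase h.choose)
      else pruneTime k σ a N U (Q.erase h.choose)
    else 0

/-- `F` is invariant under permutations of the points of `U`. -/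
def SwapInvariant (F : Finset (P → V)) (U : Finset P) : Prop :=
  ∀ a ∈ F, ∀ i ∈ U, ∀ j ∈ U, a ∘ Equiv.swap i j ∈ F

omit [DecidableEq P] in
theorem mem_binOf {a : P → V} {U : Finset P} {i j : P} :
    i ∈ binOf a U j ↔ i ∈ U ∧ a i = a j := by
  simp [binOf]

theorem mem_of_swap {U : Finset P} {i j x : P} (hi : i ∈ U) (hj : j ∈ U) :
    Equiv.swap i j x ∈ U ↔ x ∈ U := by
  rw [Equiv.swap_apply_def]
  split_ifs with h1 h2
  · simp [h1, hi, hj]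
  · simp [h2, hi, hj]
  · rfl

theorem binOf_comp_swap (a : P → V) {U : Finset P} {i j : P} (hi : i ∈ U) (hj : j ∈ U) (x : P) :
    binOf (a ∘ Equiv.swap i j) U x = (binOf a U (Equiv.swap i j x)).map
      (Equiv.swap i j).toEmbedding := by
  ext y
  simp only [mem_binOf, Finset.mem_map_equiv, Equiv.symm_swap, Function.comp, mem_of_swap hi hj]

theorem card_binOf_comp_swap (a : P → V) {U : Finset P} {i j : P} (hi : i ∈ U) (hj : j ∈ U)
    (x : P) :
    (binOf (a ∘ Equiv.swap i j) U x).card = (binOf a U (Equiv.swap i j x)).card := by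
  rw [binOf_comp_swap a hi hj, Finset.card_map]

/-- In an exchangeable family, all points are equally likely to lie in a bin of size `k`. -/
theorem card_mul_card_filter (k : ℕ) {F : Finset (P → V)} {U : Finset P} (hF : SwapInvariant F U)
    {j : P} (hj : j ∈ U) :
    U.card * (F.filter fun a => (binOf a U j).card = k).card
      = ∑ a ∈ F, (minimalPoints k a U).card := by
  have h1 : ∀ i ∈ U, (F.filter fun a => (binOf a U i).card = k).card
      = (F.filter fun a => (binOf a U j).card = k).card := by
    intro i hi
    refine Finset.card_bij' (fun a _ => a ∘ Equiv.swap i j) (fun a _ => a ∘ Equiv.swap i j)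
      ?_ ?_ ?_ ?_
    · intro a ha
      rw [Finset.mem_filter] at ha ⊢
      refine ⟨hF a ha.1 i hi j hj, ?_⟩
      rw [card_binOf_comp_swap a hi hj, Equiv.swap_apply_right]
      exact ha.2
    · intro a ha
      rw [Finset.mem_filter] at ha ⊢
      refine ⟨hF a ha.1 i hi j hj, ?_⟩
      rw [card_binOf_comp_swap a hi hj, Equiv.swap_apply_left]
      exact ha.2
    · intro a _
      funext x
      simp
    · intro a _
      funext x
      simp
  have h2 : ∑ a ∈ F, (minimalPoints k a U).card
      = ∑ i ∈ U, (F.filter fun a => (binOf a U i).card = k).card := by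
    simp only [minimalPoints, Finset.card_filter]
    exact Finset.sum_comm
  rw [h2, Finset.sum_congr rfl h1, Finset.sum_const, smul_eq_mul]

/-- Only the bin of `j` changes. It can become minimal by dropping from k + 1 points to k, which
creates k new minimal points. -/
theorem card_minimalPoints_erase_le {k : ℕ} (a : P → V) (U : Finset P) {j : P} (hj : j ∈ U) :
    (minimalPoints k a (U.erase j)).card ≤ (minimalPoints k a U).card + k := by
  by_cases hc : (binOf a (U.erase j) j).card = k
  · have hsub : minimalPoints k a (U.erase j) ⊆ minimalPoints k a U ∪ binOf a (U.erase j) j := by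
      intro i hi
      simp only [minimalPoints, Finset.mem_filter, Finset.mem_union] at hi ⊢
      by_cases hij : a i = a j
      · exact Or.inr (mem_binOf.2 ⟨hi.1, hij⟩)
      · refine Or.inl ⟨Finset.mem_of_mem_erase hi.1, ?_⟩
        rw [← hi.2]
        congr 1
        ext x
        simp only [mem_binOf, Finset.mem_erase]
        constructor
        · rintro ⟨hx, hxi⟩
          refine ⟨⟨?_, hx⟩, hxi⟩
          rintro rfl
          exact hij hxi.symm
        · rintro ⟨⟨_, hx⟩, hxi⟩
          exact ⟨hx, hxi⟩
    calc _ ≤ _ := Finset.card_le_card hsub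
      _ ≤ _ := Finset.card_union_le _ _
      _ = _ := by rw [hc]
  · have hsub : minimalPoints k a (U.erase j) ⊆ minimalPoints k a U := by
      intro i hi
      simp only [minimalPoints, Finset.mem_filter] at hi ⊢
      have hij : a i ≠ a j := by
        intro hij
        apply hc
        rw [← hi.2]
        congr 1
        ext x
        simp only [mem_binOf, hij]
      refine ⟨Finset.mem_of_mem_erase hi.1, ?_⟩
      rw [← hi.2]
      congr 1
      ext x
      simp only [mem_binOf, Finset.mem_erase]
      constructor
      · rintro ⟨hx, hxi⟩
        refine ⟨⟨?_, hx⟩, hxi⟩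
        rintro rfl
        exact hij hxi.symm
      · rintro ⟨⟨_, hx⟩, hxi⟩
        exact ⟨hx, hxi⟩
    exact (Finset.card_le_card hsub).trans (Nat.le_add_right _ _)

/-- Removing a whole bin leaves every other bin untouched. -/
theorem minimalPoints_sdiff_subset {k : ℕ} (a : P → V) (U : Finset P) (j : P) :
    minimalPoints k a (U \ binOf a U j) ⊆ minimalPoints k a U := by
  intro i hi
  simp only [minimalPoints, Finset.mem_filter, Finset.mem_sdiff, mem_binOf, not_and] at hi ⊢
  refine ⟨hi.1.1, ?_⟩
  rw [← hi.2]
  congr 1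
  ext x
  simp only [mem_binOf, Finset.mem_sdiff, not_and]
  constructor
  · rintro ⟨hx, hxi⟩
    exact ⟨⟨hx, fun _ h => hi.1.2 hi.1.1 (hxi ▸ h)⟩, hxi⟩
  · rintro ⟨⟨hx, _⟩, hxi⟩
    exact ⟨hx, hxi⟩

/-- The mean of the pruning time over an exchangeable family of subcritical allocations. -/
theorem sum_pruneTime_le {k : ℕ} (hk : 1 ≤ k) (σ : P → P) {δ : ℝ} (hδ : 0 < δ) (hδ1 : δ ≤ 1)
    (N : ℕ) (U Q : Finset P) (F : Finset (P → V)) (hF : SwapInvariant F U)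
    (hsub : ∀ a ∈ F, ((k : ℝ) - 1) * (minimalPoints k a U).card + (k : ℝ) ^ 2 * N
      ≤ (1 - δ) * U.card) :
    ∑ a ∈ F, (pruneTime k σ a N U Q : ℝ) ≤ F.card * Q.card / δ := by
  have hk' : (1 : ℝ) ≤ k := by exact_mod_cast hk
  -- `F` is the class of allocations consistent with the history, so it shrinks along the induction
  -- while staying invariant under swaps of the present points. The slack k²N pays for the drift of
  -- the hypothesis: one step raises (k-1)·#minimal - (1-δ)·#U by at most k².
  induction N generalizing U Q F with
  | zero =>
    simp only [pruneTime, Nat.cast_zero, Finset.sum_const_zero]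
    positivity
  | succ N ih =>
    by_cases hQ : Q.Nonempty
    swap
    · simp only [pruneTime, hQ, dite_false, Nat.cast_zero, Finset.sum_const_zero]
      positivity
    set j := hQ.choose with hj
    have hjQ : j ∈ Q := hQ.choose_spec
    have hQc : ((Q.erase j).card : ℝ) = Q.card - 1 := by
      rw [Finset.card_erase_of_mem hjQ, Nat.cast_sub (Finset.card_pos.2 hQ), Nat.cast_one]
    push_cast at hsub
    by_cases hjU : j ∈ U
    swap
    -- The point was already removed with its bin: the step costs 1 ≤ 1/δ and shortens the queue by
    -- one.
    · have h1 := ih U (Q.erase j) F hF (fun a ha => by nlinarith [hsub a ha])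
      simp only [pruneTime, hQ, dite_true, ← hj, hjU, if_false, Nat.cast_add, Nat.cast_one,
        Finset.sum_add_distrib, Finset.sum_const, nsmul_eq_mul, mul_one]
      rw [hQc] at h1
      have h2 : (F.card : ℝ) ≤ F.card / δ := le_div_self (by positivity) hδ hδ1
      calc (F.card : ℝ) + ∑ a ∈ F, (pruneTime k σ a N U (Q.erase j) : ℝ)
          ≤ F.card / δ + F.card * (Q.card - 1) / δ := add_le_add h2 h1
        _ = F.card * Q.card / δ := by ring
    -- Only whether the bin of `j` is minimal is revealed; in the non-minimal case nothing more is
    -- needed, since the next state is the same for all of `H`.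
    set L := F.filter fun a => (binOf a U j).card = k with hL
    set H := F.filter fun a => ¬ (binOf a U j).card = k with hH
    have hsplit : L.card + H.card = F.card := Finset.card_filter_add_card_filter_not _
    have hjj : ∀ a : P → V, j ∈ binOf a U j := fun a => mem_binOf.2 ⟨hjU, rfl⟩
    have hHsum : ∑ a ∈ H, (pruneTime k σ a N (U.erase j) (Q.erase j) : ℝ)
        ≤ H.card * (Q.card - 1) / δ := by
      rw [← hQc]
      refine ih _ _ _ ?_ ?_
      · intro a ha x hx y hy
        rw [hH, Finset.mem_filter] at ha ⊢
        have hx' := Finset.mem_erase.1 hx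
        have hy' := Finset.mem_erase.1 hy
        refine ⟨hF a ha.1 x hx'.2 y hy'.2, ?_⟩
        rw [card_binOf_comp_swap a hx'.2 hy'.2, Equiv.swap_apply_of_ne_of_ne hx'.1.symm hy'.1.symm]
        exact ha.2
      · intro a ha
        have h1 := hsub a (Finset.mem_filter.1 ha).1
        have h2 : ((minimalPoints k a (U.erase j)).card : ℝ) ≤ (minimalPoints k a U).card + k := by
          exact_mod_cast card_minimalPoints_erase_le a U hjU
        have h3 : ((U.erase j).card : ℝ) = U.card - 1 := by
          rw [Finset.card_erase_of_mem hjU, Nat.cast_sub (Finset.card_pos.2 ⟨j, hjU⟩),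
            Nat.cast_one]
        rw [h3]
        nlinarith [mul_le_mul_of_nonneg_left h2 (sub_nonneg.2 hk')]
    have hLsum : ∑ a ∈ L, (pruneTime k σ a N (U \ binOf a U j)
        (Q.erase j ∪ ((binOf a U j).erase j).image σ) : ℝ)
        ≤ L.card * (Q.card - 1 + (k - 1)) / δ := by
      -- In the minimal case the next state depends on the bin, so `L` is split by the actual bin
      -- `S`. On each fibre the state is constant, and swaps outside `S` preserve the fibre.
      have hmaps : ∀ a ∈ L, binOf a U j ∈ U.powerset := fun a _ =>
        Finset.mem_powerset.2 (Finset.filter_subset _ _)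
      rw [← Finset.sum_fiberwise_of_maps_to hmaps, Finset.card_eq_sum_card_fiberwise hmaps]
      push_cast
      rw [Finset.sum_mul, Finset.sum_div]
      refine Finset.sum_le_sum fun S _ => ?_
      have hcongr : ∑ a ∈ L with binOf a U j = S, (pruneTime k σ a N (U \ binOf a U j)
          (Q.erase j ∪ ((binOf a U j).erase j).image σ) : ℝ)
          = ∑ a ∈ L with binOf a U j = S, (pruneTime k σ a N (U \ S)
          (Q.erase j ∪ (S.erase j).image σ) : ℝ) :=
        Finset.sum_congr rfl fun a ha => by rw [(Finset.mem_filter.1 ha).2]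
      rw [hcongr]
      rcases (L.filter fun a => binOf a U j = S).eq_empty_or_nonempty with he | ⟨a₀, ha₀⟩
      · simp [he]
      have ha₀' := Finset.mem_filter.1 ha₀
      have hScard : S.card = k := by
        rw [← ha₀'.2]
        exact (Finset.mem_filter.1 ha₀'.1).2
      have hjS : j ∈ S := ha₀'.2 ▸ hjj a₀
      have hSU : S ⊆ U := ha₀'.2 ▸ Finset.filter_subset _ _
      refine (ih (U \ S) (Q.erase j ∪ (S.erase j).image σ) _ ?_ ?_).trans ?_
      · intro a ha x hx y hy
        have hx' := Finset.mem_sdiff.1 hx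
        have hy' := Finset.mem_sdiff.1 hy
        have ha' := Finset.mem_filter.1 ha
        have ha'' := Finset.mem_filter.1 ha'.1
        have hxj : j ≠ x := fun h => hx'.2 (h ▸ hjS)
        have hyj : j ≠ y := fun h => hy'.2 (h ▸ hjS)
        have hb : binOf (a ∘ Equiv.swap x y) U j = S := by
          rw [binOf_comp_swap a hx'.1 hy'.1, Equiv.swap_apply_of_ne_of_ne hxj hyj, ha'.2]
          ext z
          rw [Finset.mem_map_equiv, Equiv.symm_swap, Equiv.swap_apply_def]
          split_ifs with h1 h2
          · simp [h1, hx'.2, hy'.2]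
          · simp [h2, hx'.2, hy'.2]
          · rfl
        exact Finset.mem_filter.2 ⟨Finset.mem_filter.2 ⟨hF a ha''.1 x hx'.1 y hy'.1,
          by rw [hb, hScard]⟩, hb⟩
      · intro a ha
        have ha' := Finset.mem_filter.1 ha
        have h1 := hsub a (Finset.mem_filter.1 ha'.1).1
        have h2 : ((minimalPoints k a (U \ S)).card : ℝ) ≤ (minimalPoints k a U).card := by
          rw [← ha'.2]
          exact_mod_cast Finset.card_le_card (minimalPoints_sdiff_subset a U j)
        have h3 : ((U \ S).card : ℝ) = U.card - k := by
          rw [Finset.card_sdiff_of_subset hSU, Nat.cast_sub (Finset.card_le_card hSU), hScard]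
        rw [h3]
        nlinarith [mul_le_mul_of_nonneg_left h2 (sub_nonneg.2 hk')]
      · have h4 : ((Q.erase j ∪ (S.erase j).image σ).card : ℝ) ≤ Q.card - 1 + (k - 1) := by
          have h5 : (S.erase j).card = k - 1 := by rw [Finset.card_erase_of_mem hjS, hScard]
          have h6 : (Q.erase j ∪ (S.erase j).image σ).card ≤ (Q.erase j).card + (k - 1) :=
            (Finset.card_union_le _ _).trans
              (Nat.add_le_add_left (Finset.card_image_le.trans h5.le) _)
          have h7 : ((Q.erase j ∪ (S.erase j).image σ).card : ℝ)
              ≤ (Q.erase j).card + ((k - 1 : ℕ) : ℝ) := by exact_mod_cast h6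
          rw [Nat.cast_sub hk, hQc, Nat.cast_one] at h7
          exact h7
        gcongr
    -- The drift: by exchangeability the mean number of newly queued points is at most 1 - δ, which
    -- together with the one point removed lowers the mean queue length by at least δ.
    have hprob : ((k : ℝ) - 1) * L.card ≤ (1 - δ) * F.card := by
      have h1 := card_mul_card_filter k hF hjU
      have h2 : (U.card : ℝ) * L.card = ∑ a ∈ F, ((minimalPoints k a U).card : ℝ) := by
        exact_mod_cast h1
      have hU : (0 : ℝ) < U.card := by exact_mod_cast Finset.card_pos.2 ⟨j, hjU⟩
      have h3 : ((k : ℝ) - 1) * ∑ a ∈ F, ((minimalPoints k a U).card : ℝ)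
          ≤ ∑ a ∈ F, (1 - δ) * U.card := by
        rw [Finset.mul_sum]
        refine Finset.sum_le_sum fun a ha => ?_
        have := hsub a ha
        have : 0 ≤ (k : ℝ) ^ 2 * (N + 1) := by positivity
        linarith
      rw [← h2, Finset.sum_const, nsmul_eq_mul] at h3
      refine le_of_mul_le_mul_left ?_ hU
      linarith
    have hsum : ∑ a ∈ F, (pruneTime k σ a (N + 1) U Q : ℝ)
        = F.card + (∑ a ∈ L, (pruneTime k σ a N (U \ binOf a U j)
            (Q.erase j ∪ ((binOf a U j).erase j).image σ) : ℝ)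
          + ∑ a ∈ H, (pruneTime k σ a N (U.erase j) (Q.erase j) : ℝ)) := by
      simp only [pruneTime, hQ, dite_true, ← hj, hjU, if_true, Nat.cast_add, Nat.cast_one,
        Finset.sum_add_distrib, Finset.sum_const, nsmul_eq_mul, mul_one]
      rw [hL, hH, ← Finset.sum_ite]
      congr 1
      refine Finset.sum_congr rfl fun a _ => ?_
      split_ifs <;> rfl
    rw [hsum]
    have hFc : (F.card : ℝ) = L.card + H.card := by exact_mod_cast hsplit.symm
    calc _ ≤ (F.card : ℝ) + (L.card * (Q.card - 1 + (k - 1)) / δ + H.card * (Q.card - 1) / δ) := by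
          gcongr
      _ = (F.card * δ + F.card * (Q.card - 1) + (k - 1) * L.card) / δ := by
          rw [hFc]
          field_simp
          ring
      _ ≤ F.card * Q.card / δ := by
          gcongr
          linarith

/-- If the pruning process stops before time `N`, then what remains is closed under taking
partners, has no bin with fewer than `k` points, and avoids `D`; each step costs at most one bin. -/
theorem exists_of_pruneTime_lt {k : ℕ} {σ : P → P} (hσ : Function.Involutive σ) (a : P → V)
    (D : Finset P) (N : ℕ) (U Q : Finset P) (hA : ∀ i ∈ U, i ∈ Q ∨ σ i ∈ U)
    (hB : ∀ q ∈ Q, σ q ∈ Q ∨ σ q ∉ U) (hC : ∀ i ∈ D, i ∈ U → i ∈ Q)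
    (hD : ∀ i ∈ U, k ≤ (binOf a U i).card) (hlt : pruneTime k σ a N U Q < N) :
    ∃ U' : Finset P, (∀ i ∈ U', σ i ∈ U') ∧ (∀ i ∈ D, i ∉ U') ∧
      (∀ i ∈ U', k ≤ (binOf a U' i).card) ∧
      (U.image a).card ≤ (U'.image a).card + pruneTime k σ a N U Q := by
  -- The hypotheses are the invariants of the process: a present point is queued or has a present
  -- partner; a queued point has a partner that is queued or gone; present points of `D` are queued;
  -- present bins are large enough. Once the queue is empty, they say that `U` itself is the
  -- required set.
  induction N generalizing U Q with
  | zero => exact absurd hlt (Nat.not_lt_zero _)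
  | succ N ih =>
    by_cases hQ : Q.Nonempty
    swap
    · rw [Finset.not_nonempty_iff_eq_empty] at hQ
      subst hQ
      exact ⟨U, fun i hi => (hA i hi).resolve_left (Finset.notMem_empty i),
        fun i hi hU => Finset.notMem_empty i (hC i hi hU), hD, Nat.le_add_right _ _⟩
    obtain ⟨j, hj⟩ : ∃ j, j = hQ.choose := ⟨_, rfl⟩
    have hjQ : j ∈ Q := hj ▸ hQ.choose_spec
    have himage : ∀ (W : Finset P) (t : ℕ), (∀ x ∈ U, a x = a j ∨ x ∈ W) →
        (∃ U' : Finset P, (∀ i ∈ U', σ i ∈ U') ∧ (∀ i ∈ D, i ∉ U') ∧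
          (∀ i ∈ U', k ≤ (binOf a U' i).card) ∧ (W.image a).card ≤ (U'.image a).card + t) →
        ∃ U' : Finset P, (∀ i ∈ U', σ i ∈ U') ∧ (∀ i ∈ D, i ∉ U') ∧
          (∀ i ∈ U', k ≤ (binOf a U' i).card) ∧
          (U.image a).card ≤ (U'.image a).card + (1 + t) := by
      rintro W t hW ⟨U', h1, h2, h3, h4⟩
      refine ⟨U', h1, h2, h3, ?_⟩
      have h5 : U.image a ⊆ insert (a j) (W.image a) := by
        intro v hv
        obtain ⟨x, hx, rfl⟩ := Finset.mem_image.1 hv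
        rcases hW x hx with h | h
        · exact h ▸ Finset.mem_insert_self _ _
        · exact Finset.mem_insert_of_mem (Finset.mem_image_of_mem a h)
      have := (Finset.card_le_card h5).trans (Finset.card_insert_le _ _)
      omega
    simp only [pruneTime, hQ, dite_true, ← hj] at hlt ⊢
    by_cases hjU : j ∈ U
    swap
    · simp only [hjU, if_false] at hlt ⊢
      refine himage U _ (fun x hx => Or.inr hx) (ih _ _ ?_ ?_ ?_ hD (by omega))
      · intro i hi
        refine (hA i hi).imp_left fun h => Finset.mem_erase.2 ⟨?_, h⟩
        rintro rfl
        exact hjU hi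
      · intro q hq
        rcases hB q (Finset.mem_of_mem_erase hq) with h | h
        · by_cases hqj : σ q = j
          · exact Or.inr (hqj ▸ hjU)
          · exact Or.inl (Finset.mem_erase.2 ⟨hqj, h⟩)
        · exact Or.inr h
      · intro i hi hiU
        refine Finset.mem_erase.2 ⟨?_, hC i hi hiU⟩
        rintro rfl
        exact hjU hiU
    -- Removing `j` strands no partner: by `hB` at `j`, a partner that is still present is itself
    -- queued.
    have hpartner : ∀ i ∈ U, i ≠ j → σ i = j → i ∈ Q.erase j := by
      intro i hi hij hs
      have : σ j = i := by rw [← hs, hσ]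
      rcases hB j hjQ with h | h
      · exact Finset.mem_erase.2 ⟨hij, this ▸ h⟩
      · exact absurd (this ▸ hi) h
    simp only [hjU, if_true] at hlt ⊢
    by_cases hc : (binOf a U j).card = k
    · simp only [hc, if_true] at hlt ⊢
      have hne : ∀ i ∈ U \ binOf a U j, i ≠ j := by
        rintro i hi rfl
        exact (Finset.mem_sdiff.1 hi).2 (mem_binOf.2 ⟨hjU, rfl⟩)
      refine himage (U \ binOf a U j) _ ?_ (ih _ _ ?_ ?_ ?_ ?_ (by omega))
      · intro x hx
        by_cases h : a x = a j
        · exact Or.inl h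
        · exact Or.inr (Finset.mem_sdiff.2 ⟨hx, fun h' => h (mem_binOf.1 h').2⟩)
      · intro i hi
        have hi' := Finset.mem_sdiff.1 hi
        rcases hA i hi'.1 with h | h
        · exact Or.inl (Finset.mem_union_left _ (Finset.mem_erase.2 ⟨hne i hi, h⟩))
        · by_cases hsj : σ i = j
          · exact Or.inl (Finset.mem_union_left _ (hpartner i hi'.1 (hne i hi) hsj))
          by_cases hsb : σ i ∈ binOf a U j
          · exact Or.inl (Finset.mem_union_right _ (Finset.mem_image.2
              ⟨σ i, Finset.mem_erase.2 ⟨hsj, hsb⟩, hσ i⟩))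
          · exact Or.inr (Finset.mem_sdiff.2 ⟨h, hsb⟩)
      · intro q hq
        rcases Finset.mem_union.1 hq with h | h
        · rcases hB q (Finset.mem_of_mem_erase h) with h' | h'
          · by_cases hqj : σ q = j
            · exact Or.inr fun h'' => hne _ h'' hqj
            · exact Or.inl (Finset.mem_union_left _ (Finset.mem_erase.2 ⟨hqj, h'⟩))
          · exact Or.inr fun h'' => h' (Finset.mem_sdiff.1 h'').1
        · obtain ⟨b, hb, rfl⟩ := Finset.mem_image.1 h
          refine Or.inr fun h'' => ?_
          rw [hσ] at h''
          exact (Finset.mem_sdiff.1 h'').2 (Finset.mem_of_mem_erase hb)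
      · intro i hi hiU
        exact Finset.mem_union_left _ (Finset.mem_erase.2
          ⟨hne i hiU, hC i hi (Finset.mem_sdiff.1 hiU).1⟩)
      · intro i hi
        have hi' := Finset.mem_sdiff.1 hi
        refine (hD i hi'.1).trans (Finset.card_le_card fun x hx => ?_)
        have hx' := mem_binOf.1 hx
        refine mem_binOf.2 ⟨Finset.mem_sdiff.2 ⟨hx'.1, fun h => hi'.2 ?_⟩, hx'.2⟩
        exact mem_binOf.2 ⟨hi'.1, hx'.2.symm.trans (mem_binOf.1 h).2⟩
    · simp only [hc, if_false] at hlt ⊢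
      refine himage (U.erase j) _ ?_ (ih _ _ ?_ ?_ ?_ ?_ (by omega))
      · intro x hx
        by_cases h : x = j
        · exact Or.inl (h ▸ rfl)
        · exact Or.inr (Finset.mem_erase.2 ⟨h, hx⟩)
      · intro i hi
        have hi' := Finset.mem_erase.1 hi
        rcases hA i hi'.2 with h | h
        · exact Or.inl (Finset.mem_erase.2 ⟨hi'.1, h⟩)
        · by_cases hsj : σ i = j
          · exact Or.inl (hpartner i hi'.2 hi'.1 hsj)
          · exact Or.inr (Finset.mem_erase.2 ⟨hsj, h⟩)
      · intro q hq
        rcases hB q (Finset.mem_of_mem_erase hq) with h | h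
        · by_cases hqj : σ q = j
          · exact Or.inr (hqj ▸ Finset.notMem_erase j U)
          · exact Or.inl (Finset.mem_erase.2 ⟨hqj, h⟩)
        · exact Or.inr fun h' => h (Finset.mem_of_mem_erase h')
      · intro i hi hiU
        have hi' := Finset.mem_erase.1 hiU
        exact Finset.mem_erase.2 ⟨hi'.1, hC i hi hi'.2⟩
      · intro i hi
        have hi' := Finset.mem_erase.1 hi
        have heq : binOf a (U.erase j) i = (binOf a U i).erase j := by
          ext x
          simp only [mem_binOf, Finset.mem_erase, and_assoc]
        rw [heq]
        by_cases hij : a i = a j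
        · have h1 : binOf a U i = binOf a U j := by
            ext x
            simp only [mem_binOf, hij]
          have h2 := hD j hjU
          rw [h1, Finset.card_erase_of_mem (mem_binOf.2 ⟨hjU, rfl⟩)]
          omega
        · rw [Finset.erase_eq_of_notMem fun h => hij (mem_binOf.1 h).2.symm]
          exact hD i hi'.2

end Exploration

/-! ### The allocation graph -/

/-- The other end of the edge to which the point `i` belongs. -/
def partner {m : ℕ} (i : Fin (2 * m)) : Fin (2 * m) :=
  if h : (i : ℕ) < m then ⟨m + i, by omega⟩ else ⟨i - m, by omega⟩

/-- The edge to which the point `i` belongs. -/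
def edgeOf {m : ℕ} (i : Fin (2 * m)) : Fin m :=
  if h : (i : ℕ) < m then ⟨i, h⟩ else ⟨i - m, by omega⟩

/-- The first point of an edge. -/
def firstPoint {m : ℕ} (e : Fin m) : Fin (2 * m) := ⟨e, by omega⟩

/-- The second point of an edge. -/
def secondPoint {m : ℕ} (e : Fin m) : Fin (2 * m) := ⟨m + e, by omega⟩

theorem partner_involutive {m : ℕ} : Function.Involutive (partner (m := m)) := by
  intro i
  ext
  unfold partner
  split_ifs with h1 h2 h2 <;> simp at h2 ⊢ <;> omega

theorem partner_firstPoint {m : ℕ} (e : Fin m) : partner (firstPoint e) = secondPoint e := by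
  simp [partner, firstPoint, secondPoint]

theorem partner_secondPoint {m : ℕ} (e : Fin m) : partner (secondPoint e) = firstPoint e := by
  rw [← partner_firstPoint, partner_involutive]

theorem eq_firstPoint_or_eq_secondPoint {m : ℕ} (i : Fin (2 * m)) :
    i = firstPoint (edgeOf i) ∨ i = secondPoint (edgeOf i) := by
  unfold edgeOf firstPoint secondPoint
  by_cases h : (i : ℕ) < m
  · exact Or.inl (by simp [h])
  · refine Or.inr ?_
    ext
    simp only [h, dite_false]
    omega

theorem isLink_allocationGraph {n m : ℕ} (a : Fin (2 * m) → Fin n) (e : Fin m) (x y : Fin n) :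
    (allocationGraph a).IsLink e x y ↔ s(x, y) = s(a (firstPoint e), a (secondPoint e)) :=
  Iff.rfl

/-- The subgraph of the allocation graph that is formed by a set of points closed under taking
partners. -/
def pointSubgraph {n m : ℕ} (a : Fin (2 * m) → Fin n) (U : Finset (Fin (2 * m))) :
    Graph (Fin n) (Fin m) :=
  ((allocationGraph a).restrict {e | firstPoint e ∈ U ∧ secondPoint e ∈ U}).induce
    {v | ∃ i ∈ U, a i = v}

theorem pointSubgraph_isLink {n m : ℕ} (a : Fin (2 * m) → Fin n) (U : Finset (Fin (2 * m)))
    (e : Fin m) (x y : Fin n) : (pointSubgraph a U).IsLink e x y ↔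
      (firstPoint e ∈ U ∧ secondPoint e ∈ U) ∧
        s(x, y) = s(a (firstPoint e), a (secondPoint e)) := by
  simp only [pointSubgraph, Graph.induce_isLink, Graph.restrict_isLink, isLink_allocationGraph,
    Set.mem_ofPred_eq]
  constructor
  · rintro ⟨⟨h1, h2⟩, -⟩
    exact ⟨by simpa using h1, h2⟩
  · rintro ⟨h1, h2⟩
    refine ⟨⟨by simpa using h1, h2⟩, ?_⟩
    rcases Sym2.eq_iff.1 h2 with ⟨rfl, rfl⟩ | ⟨rfl, rfl⟩
    · exact ⟨⟨_, h1.1, rfl⟩, ⟨_, h1.2, rfl⟩⟩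
    · exact ⟨⟨_, h1.2, rfl⟩, ⟨_, h1.1, rfl⟩⟩

/-- With A and B the edges whose first, respectively second, point lies in the bin, the bin has at
most |A| + |B| = |A ∪ B| + |A ∩ B| points. The union consists of incident edges and the intersection
of loops, which is how the degree counts them. -/
theorem minDegreeGE_pointSubgraph {k n m : ℕ} (a : Fin (2 * m) → Fin n)
    {U : Finset (Fin (2 * m))} (hU : ∀ i ∈ U, partner i ∈ U)
    (hk : ∀ i ∈ U, k ≤ (binOf a U i).card) : MinDegreeGE k (pointSubgraph a U) := by
  rintro v ⟨i, hi, rfl⟩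
  set A : Set (Fin m) := {e | firstPoint e ∈ binOf a U i} with hA
  set B : Set (Fin m) := {e | secondPoint e ∈ binOf a U i} with hB
  have hfs : ∀ e : Fin m, firstPoint e ∈ U → secondPoint e ∈ U := fun e he =>
    partner_firstPoint e ▸ hU _ he
  have hsf : ∀ e : Fin m, secondPoint e ∈ U → firstPoint e ∈ U := fun e he =>
    partner_secondPoint e ▸ hU _ he
  have h1 : ((binOf a U i : Finset (Fin (2 * m))) : Set (Fin (2 * m)))
      ⊆ firstPoint '' A ∪ secondPoint '' B := by
    intro x hx
    have hx : x ∈ binOf a U i := hx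
    rcases eq_firstPoint_or_eq_secondPoint x with h | h
    · exact Or.inl ⟨edgeOf x, by rw [h] at hx; exact hx, h.symm⟩
    · exact Or.inr ⟨edgeOf x, by rw [h] at hx; exact hx, h.symm⟩
  have h2 : A ∪ B ⊆ (pointSubgraph a U).incidenceSet (a i) := by
    rintro e (he | he)
    · obtain ⟨hU', ha⟩ := mem_binOf.1 he
      exact ⟨_, (pointSubgraph_isLink a U e _ (a (secondPoint e))).2
        ⟨⟨hU', hfs e hU'⟩, by rw [ha]⟩⟩
    · obtain ⟨hU', ha⟩ := mem_binOf.1 he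
      exact ⟨_, (pointSubgraph_isLink a U e _ (a (firstPoint e))).2
        ⟨⟨hsf e hU', hU'⟩, by rw [ha, Sym2.eq_swap]⟩⟩
  have h3 : A ∩ B ⊆ (pointSubgraph a U).loopSet (a i) := by
    rintro e ⟨he, he'⟩
    obtain ⟨hU1, ha1⟩ := mem_binOf.1 he
    obtain ⟨hU2, ha2⟩ := mem_binOf.1 he'
    exact (pointSubgraph_isLink a U e _ _).2 ⟨⟨hU1, hU2⟩, by rw [ha1, ha2]⟩
  calc (k : ℕ∞) ≤ ((binOf a U i).card : ℕ∞) := by exact_mod_cast hk i hi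
    _ = ((binOf a U i : Finset (Fin (2 * m))) : Set (Fin (2 * m))).encard :=
        (Set.encard_coe_eq_coe_finsetCard _).symm
    _ ≤ (firstPoint '' A ∪ secondPoint '' B).encard := Set.encard_le_encard h1
    _ ≤ (firstPoint '' A).encard + (secondPoint '' B).encard := Set.encard_union_le _ _
    _ ≤ A.encard + B.encard := add_le_add (Set.encard_image_le _ _) (Set.encard_image_le _ _)
    _ = (A ∪ B).encard + (A ∩ B).encard := (Set.encard_union_add_encard_inter A B).symm
    _ ≤ _ := add_le_add (Set.encard_le_encard h2) (Set.encard_le_encard h3)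

theorem pointSubgraph_le_deleteEdges {n m : ℕ} (a : Fin (2 * m) → Fin n)
    {U : Finset (Fin (2 * m))} {e : Fin m} (he : firstPoint e ∉ U) :
    pointSubgraph a U ≤ (allocationGraph a).deleteEdges {e} := by
  refine ⟨fun v _ => Set.mem_univ v, fun f x y h => ?_⟩
  rw [pointSubgraph_isLink] at h
  rw [Graph.deleteEdges_isLink]
  refine ⟨h.2, ?_⟩
  rintro rfl
  exact he h.1.1

/-- The surviving points span a subgraph of minimum degree at least k without the edge `e`, hence
inside the core. Every bin is occupied at the start because `1 ≤ k`, so lost bins account for all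
lost vertices. -/
theorem lostVertices_le_pruneTime {k n m N : ℕ} (hk : 1 ≤ k) {a : Fin (2 * m) → Fin n}
    (ha : a ∈ allocations k n m) (e : Fin m)
    (hN : pruneTime k partner a N Finset.univ {firstPoint e, secondPoint e} < N) :
    lostVertices k (allocationGraph a) e
      ≤ pruneTime k partner a N Finset.univ {firstPoint e, secondPoint e} := by
  have hbin : ∀ v, k ≤ (Finset.univ.filter fun i => a i = v).card := by
    intro v
    have := ha v
    rwa [← Finset.coe_filter_univ, Set.ncard_coe_finset] at this
  obtain ⟨U, h1, h2, h3, h4⟩ := exists_of_pruneTime_lt (k := k) partner_involutive a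
    {firstPoint e, secondPoint e} N Finset.univ {firstPoint e, secondPoint e}
    (fun i _ => Or.inr (Finset.mem_univ _)) (by
      intro q hq
      rw [Finset.mem_insert, Finset.mem_singleton] at hq
      left
      rcases hq with rfl | rfl
      · simp [partner_firstPoint]
      · simp [partner_secondPoint]) (fun i hi _ => hi) (fun i _ => hbin (a i)) hN
  have hsurj : (Finset.univ : Finset (Fin (2 * m))).image a = Finset.univ := by
    ext v
    simp only [Finset.mem_image, Finset.mem_univ, true_and, iff_true]
    obtain ⟨i, hi⟩ := Finset.card_pos.1 (lt_of_lt_of_le hk (hbin v))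
    exact ⟨i, (Finset.mem_filter.1 hi).2⟩
  have hcore : ((U.image a : Finset (Fin n)) : Set (Fin n))
      ⊆ (kCore k ((allocationGraph a).deleteEdges {e})).vertexSet := by
    intro v hv
    obtain ⟨i, hi, rfl⟩ := Finset.mem_image.1 hv
    exact ⟨pointSubgraph a U, pointSubgraph_le_deleteEdges a (h2 _ (by simp)),
      minDegreeGE_pointSubgraph a h1 h3, i, hi, rfl⟩
  have h5 := Set.ncard_le_ncard hcore (Set.toFinite _)
  rw [Set.ncard_coe_finset] at h5
  rw [hsurj] at h4
  have h6 : (allocationGraph a).vertexSet.ncard = (Finset.univ : Finset (Fin n)).card := by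
    rw [← Set.ncard_coe_finset, Finset.coe_univ]
    rfl
  unfold lostVertices
  omega

/-- In an exchangeable family of subcritical allocations, few vertices are lost with high
probability, whichever edge is deleted. -/
theorem card_filter_lostVertices_mul_le {k n m : ℕ} (hk : 1 ≤ k) {δ : ℝ} (hδ : 0 < δ)
    (hδ1 : δ ≤ 1) {N : ℕ} (F : Finset (Fin (2 * m) → Fin n))
    (hF : SwapInvariant F Finset.univ) (hFa : ∀ a ∈ F, a ∈ allocations k n m)
    (hsub : ∀ a ∈ F, ((k : ℝ) - 1) * (minimalPoints k a Finset.univ).card + (k : ℝ) ^ 2 * N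
      ≤ (1 - δ) * (2 * m)) (e : Fin m) :
    ((F.filter fun a => N ≤ lostVertices k (allocationGraph a) e).card : ℝ) * N
      ≤ F.card * 2 / δ := by
  have h1 := sum_pruneTime_le hk partner hδ hδ1 N Finset.univ {firstPoint e, secondPoint e} F hF
    (fun a ha => by simpa using hsub a ha)
  have h2 : ((F.filter fun a => N ≤ lostVertices k (allocationGraph a) e).card : ℝ) * N
      ≤ ∑ a ∈ F, (pruneTime k partner a N Finset.univ {firstPoint e, secondPoint e} : ℝ) := by
    rw [← nsmul_eq_mul, ← Finset.sum_const, Finset.sum_filter]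
    refine Finset.sum_le_sum fun a ha => ?_
    split_ifs with h
    -- The duration is capped at `N`; a value below the cap means that the queue did run empty, and
    -- then fewer than `N` vertices are lost.
    · by_contra! hlt
      have hlt : pruneTime k partner a N Finset.univ {firstPoint e, secondPoint e} < N := by
        exact_mod_cast hlt
      have := lostVertices_le_pruneTime hk (hFa a ha) e hlt
      omega
    · positivity
  refine h2.trans (h1.trans ?_)
  have h3 : ((({firstPoint e, secondPoint e} : Finset (Fin (2 * m))).card : ℕ) : ℝ) ≤ 2 := by
    exact_mod_cast Finset.card_le_two
  gcongr

/-! ### Generating functions of allocations -/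

/-- The exponential generating function of a sequence of weights. -/
noncomputable def weightSeries (w : ℕ → ℝ) : PowerSeries ℝ :=
  PowerSeries.mk fun i => w i / (i.factorial : ℝ)

theorem coeff_weightSeries (w : ℕ → ℝ) (i : ℕ) :
    PowerSeries.coeff i (weightSeries w) = w i / (i.factorial : ℝ) := by
  simp [weightSeries]

/-- The sum over all allocations of `M` points to `n` bins of the product of the weights of the
bin sizes is given by the `n`-th power of the exponential generating function of the weights. -/
theorem sum_prod_weight (w : ℕ → ℝ) (n M : ℕ) :
    ∑ a : Fin M → Fin n, ∏ v, w (Finset.univ.filter fun i => a i = v).card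
      = M.factorial * PowerSeries.coeff M (weightSeries w ^ n) := by
  classical
  -- The linear functional that replaces each monomial by the product of the weights of its
  -- exponents. Evaluating it at the M-th power of the sum of the variables, expanded over words and
  -- over exponent vectors, gives both sides.
  set φ : MvPolynomial (Fin n) ℝ →ₗ[ℝ] ℝ :=
    (MvPolynomial.basisMonomials (Fin n) ℝ).constr ℝ fun d => ∏ v, w (d v) with hφ
  have hφm : ∀ d : Fin n →₀ ℕ, φ (MvPolynomial.monomial d 1) = ∏ v, w (d v) := by
    intro d
    have := (MvPolynomial.basisMonomials (Fin n) ℝ).constr_basis ℝ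
      (fun d : Fin n →₀ ℕ => ∏ v, w (d v)) d
    rwa [MvPolynomial.coe_basisMonomials] at this
  have h1 : φ ((∑ v : Fin n, MvPolynomial.X v) ^ M)
      = ∑ a : Fin M → Fin n, ∏ v, w (Finset.univ.filter fun i => a i = v).card := by
    rw [Fintype.sum_pow, map_sum]
    refine Finset.sum_congr rfl fun a _ => ?_
    have : ∏ i, (MvPolynomial.X (a i) : MvPolynomial (Fin n) ℝ)
        = MvPolynomial.monomial (∑ i, Finsupp.single (a i) 1) 1 :=
      (MvPolynomial.monomial_sum_one Finset.univ fun i => Finsupp.single (a i) 1).symm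
    rw [this, hφm]
    refine Finset.prod_congr rfl fun v _ => ?_
    rw [Finsupp.finsetSum_apply, Finset.card_filter]
    congr 1
    refine Finset.sum_congr rfl fun i _ => ?_
    rw [Finsupp.single_apply]
  have h2 : φ ((∑ v : Fin n, MvPolynomial.X v) ^ M)
      = ∑ d ∈ Finset.finsuppAntidiag (Finset.univ : Finset (Fin n)) M,
        (Nat.multinomial Finset.univ d : ℝ) * ∏ v, w (d v) := by
    rw [Finset.sum_pow_eq_sum_piAntidiag, map_sum]
    refine Finset.sum_bij' (fun d _ => Finsupp.equivFunOnFinite.symm d) (fun d _ => ⇑d)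
      ?_ ?_ ?_ ?_ ?_
    · intro d hd
      rw [Finset.mem_piAntidiag] at hd
      rw [Finset.mem_finsuppAntidiag]
      exact ⟨hd.1, Finset.subset_univ _⟩
    · intro d hd
      rw [Finset.mem_finsuppAntidiag] at hd
      rw [Finset.mem_piAntidiag]
      exact ⟨hd.1, fun _ _ => Finset.mem_univ _⟩
    · intro d _
      rfl
    · intro d _
      ext
      rfl
    · intro d _
      have : ∏ v, (MvPolynomial.X v : MvPolynomial (Fin n) ℝ) ^ d v
          = MvPolynomial.monomial (Finsupp.equivFunOnFinite.symm d) 1 := by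
        rw [MvPolynomial.monomial_eq, map_one, one_mul, Finsupp.prod_fintype _ _ (by simp)]
        rfl
      rw [this, ← nsmul_eq_mul, map_nsmul, hφm, nsmul_eq_mul]
      rfl
  rw [← h1, h2]
  have h3 : weightSeries w ^ n = ∏ _v : Fin n, weightSeries w := by simp
  rw [h3, PowerSeries.coeff_prod, Finset.mul_sum]
  refine Finset.sum_congr rfl fun d hd => ?_
  rw [Finset.mem_finsuppAntidiag] at hd
  have h4 : (M.factorial : ℝ)
      = (∏ v, ((d v).factorial : ℝ)) * Nat.multinomial Finset.univ d := by
    have := Nat.multinomial_spec Finset.univ d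
    rw [hd.1] at this
    exact_mod_cast this.symm
  simp only [coeff_weightSeries, Finset.prod_div_distrib]
  have h5 : (∏ v, ((d v).factorial : ℝ)) ≠ 0 :=
    Finset.prod_ne_zero_iff.2 fun v _ => by positivity
  rw [h4]
  field_simp

theorem coeff_mul_nonneg {p q : PowerSeries ℝ} (hp : ∀ i, 0 ≤ PowerSeries.coeff i p)
    (hq : ∀ i, 0 ≤ PowerSeries.coeff i q) (i : ℕ) : 0 ≤ PowerSeries.coeff i (p * q) := by
  rw [PowerSeries.coeff_mul]
  exact Finset.sum_nonneg fun x _ => mul_nonneg (hp _) (hq _)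

theorem coeff_pow_nonneg {p : PowerSeries ℝ} (hp : ∀ i, 0 ≤ PowerSeries.coeff i p) (n i : ℕ) :
    0 ≤ PowerSeries.coeff i (p ^ n) := by
  induction n generalizing i with
  | zero =>
    rw [pow_zero, PowerSeries.coeff_one]
    split_ifs <;> norm_num
  | succ n ih =>
    rw [pow_succ]
    exact coeff_mul_nonneg ih hp i

theorem coeff_mul_le_coeff_mul {p q q' : PowerSeries ℝ} (hp : ∀ i, 0 ≤ PowerSeries.coeff i p)
    (hq : ∀ i, PowerSeries.coeff i q ≤ PowerSeries.coeff i q') (i : ℕ) :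
    PowerSeries.coeff i (p * q) ≤ PowerSeries.coeff i (p * q') := by
  rw [PowerSeries.coeff_mul, PowerSeries.coeff_mul]
  exact Finset.sum_le_sum fun x _ => mul_le_mul_of_nonneg_left (hq _) (hp _)

theorem hasSum_coeff_pow {p : PowerSeries ℝ} {x s : ℝ}
    (hs : HasSum (fun i => PowerSeries.coeff i p * x ^ i) s) (n : ℕ) :
    HasSum (fun i => PowerSeries.coeff i (p ^ n) * x ^ i) (s ^ n) := by
  induction n with
  | zero =>
    convert! hasSum_ite_eq (0 : ℕ) (1 : ℝ) using 1
    funext i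
    rw [pow_zero, PowerSeries.coeff_one]
    split_ifs with h <;> simp [h]
  | succ n ih =>
    have h1 : Summable fun i => ‖PowerSeries.coeff i (p ^ n) * x ^ i‖ := ih.summable.abs
    have h2 : Summable fun i => ‖PowerSeries.coeff i p * x ^ i‖ := hs.summable.abs
    have h3 := (summable_norm_sum_mul_antidiagonal_of_summable_norm h1 h2).of_norm.hasSum
    rw [← tsum_mul_tsum_eq_tsum_sum_antidiagonal_of_summable_norm h1 h2, ih.tsum_eq,
      hs.tsum_eq, ← pow_succ] at h3
    refine h3.congr_fun fun i => ?_
    rw [pow_succ, PowerSeries.coeff_mul, Finset.sum_mul]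
    refine Finset.sum_congr rfl fun y hy => ?_
    rw [← Finset.HasAntidiagonal.mem_antidiagonal.1 hy, pow_add]
    ring

/-- The exponential generating function of bins with at least `k` points. -/
noncomputable def coreSeries (k : ℕ) : PowerSeries ℝ :=
  weightSeries fun i => if k ≤ i then 1 else 0

theorem coeff_coreSeries (k i : ℕ) :
    PowerSeries.coeff i (coreSeries k) = (if k ≤ i then 1 else 0) / (i.factorial : ℝ) :=
  coeff_weightSeries _ _

theorem coeff_coreSeries_nonneg (k i : ℕ) : 0 ≤ PowerSeries.coeff i (coreSeries k) := by
  rw [coeff_coreSeries]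
  split_ifs <;> positivity

theorem succ_div_factorial_succ (i : ℕ) (y : ℝ) :
    y / ((i + 1).factorial : ℝ) * (i + 1) = y / (i.factorial : ℝ) := by
  rw [Nat.factorial_succ]
  push_cast
  have h1 : (i.factorial : ℝ) ≠ 0 := by positivity
  have h2 : (i : ℝ) + 1 ≠ 0 := by positivity
  field_simp

/-- Differentiate the n-th power of F = `coreSeries k`: coefficientwise F' ≥ F, since F' is the tail
series from k - 1 on. With the next lemma this controls ratios of consecutive coefficients. -/
theorem mul_coeff_coreSeries_pow_le (k n M : ℕ) :
    (n : ℝ) * PowerSeries.coeff M (coreSeries k ^ n)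
      ≤ (M + 1) * PowerSeries.coeff (M + 1) (coreSeries k ^ n) := by
  rcases n with _ | n
  · have := coeff_pow_nonneg (coeff_coreSeries_nonneg k) 0 (M + 1)
    simp only [Nat.cast_zero, zero_mul]
    positivity
  have h1 := PowerSeries.coeff_derivative (coreSeries k ^ (n + 1)) M
  rw [PowerSeries.derivative_pow, Nat.add_sub_cancel, mul_assoc, ← nsmul_eq_mul, map_nsmul,
    nsmul_eq_mul] at h1
  rw [mul_comm ((M : ℝ) + 1), ← h1, pow_succ]
  refine mul_le_mul_of_nonneg_left ?_ (by positivity)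
  refine coeff_mul_le_coeff_mul (coeff_pow_nonneg (coeff_coreSeries_nonneg k) n) (fun i => ?_) M
  rw [PowerSeries.coeff_derivative, coeff_coreSeries, coeff_coreSeries, succ_div_factorial_succ]
  gcongr
  split_ifs with h2 h3 <;> first | omega | norm_num

/-- Here X F' ≤ kF + X F coefficientwise: for k ≥ 1 the two series X F' and X F differ only by
X^k/(k-1)!, which is the lowest term of kF. -/
theorem sub_mul_coeff_coreSeries_pow_le {k : ℕ} (n M : ℕ) :
    ((M : ℝ) + 1 - k * n) * PowerSeries.coeff (M + 1) (coreSeries k ^ n)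
      ≤ n * PowerSeries.coeff M (coreSeries k ^ n) := by
  rcases n with _ | n
  · simp [PowerSeries.coeff_one]
  have h1 := PowerSeries.coeff_derivative (coreSeries k ^ (n + 1)) M
  rw [PowerSeries.derivative_pow, Nat.add_sub_cancel, mul_assoc, ← nsmul_eq_mul, map_nsmul,
    nsmul_eq_mul] at h1
  have h2 : PowerSeries.coeff (M + 1) (coreSeries k ^ n *
        (PowerSeries.X * PowerSeries.derivative ℝ (coreSeries k)))
      ≤ PowerSeries.coeff (M + 1) (coreSeries k ^ n *
        (PowerSeries.C (k : ℝ) * coreSeries k + PowerSeries.X * coreSeries k)) := by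
    refine coeff_mul_le_coeff_mul (coeff_pow_nonneg (coeff_coreSeries_nonneg k) n) (fun i => ?_) _
    rw [map_add, PowerSeries.coeff_C_mul]
    rcases i with _ | i
    · have := coeff_coreSeries_nonneg k 0
      simp only [PowerSeries.coeff_zero_X_mul, add_zero]
      positivity
    · rw [PowerSeries.coeff_succ_X_mul, PowerSeries.coeff_succ_X_mul,
        PowerSeries.coeff_derivative, coeff_coreSeries, coeff_coreSeries, succ_div_factorial_succ]
      by_cases h3 : k ≤ i
      · simp only [h3, h3.trans (Nat.le_succ i), if_true]
        have : (0 : ℝ) ≤ k * (1 / ((i + 1).factorial : ℝ)) := by positivity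
        linarith
      · by_cases h4 : k = i + 1
        · subst h4
          simp only [h3, le_refl, if_true, if_false, zero_div, add_zero]
          rw [← succ_div_factorial_succ i 1, mul_comm]
          push_cast
          exact le_rfl
        · have h5 : ¬ k ≤ i + 1 := by omega
          simp [h3, h5]
  have h3 : coreSeries k ^ n * (PowerSeries.X * PowerSeries.derivative ℝ (coreSeries k))
      = PowerSeries.X * (coreSeries k ^ n * PowerSeries.derivative ℝ (coreSeries k)) := by ring
  have h4 : coreSeries k ^ n * (PowerSeries.C (k : ℝ) * coreSeries k
      + PowerSeries.X * coreSeries k)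
      = PowerSeries.C (k : ℝ) * coreSeries k ^ (n + 1)
        + PowerSeries.X * coreSeries k ^ (n + 1) := by ring
  rw [h3, h4, PowerSeries.coeff_succ_X_mul, map_add, PowerSeries.coeff_C_mul,
    PowerSeries.coeff_succ_X_mul] at h2
  have h5 := mul_le_mul_of_nonneg_left h2 (Nat.cast_nonneg (α := ℝ) (n + 1))
  rw [h1] at h5
  linarith

/-- The number of bins with exactly `k` points. -/
def minimalBins (k : ℕ) {n M : ℕ} (a : Fin M → Fin n) : ℕ :=
  (Finset.univ.filter fun v => (Finset.univ.filter fun i => a i = v).card = k).card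

/-- The allocations of `M` points to `n` bins with at least `k` points in every bin. -/
def coreAllocations (k n M : ℕ) : Finset (Fin M → Fin n) :=
  Finset.univ.filter fun a => ∀ v, k ≤ (Finset.univ.filter fun i => a i = v).card

theorem card_coreAllocations (k n M : ℕ) : ((coreAllocations k n M).card : ℝ)
    = M.factorial * PowerSeries.coeff M (coreSeries k ^ n) := by
  rw [coreSeries, ← sum_prod_weight, coreAllocations, Finset.card_filter]
  push_cast
  refine Finset.sum_congr rfl fun a _ => ?_
  rw [Finset.prod_boole]
  simp

/-- Weights for the moment generating function of the number of bins with exactly `k` points. -/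
noncomputable def tiltedWeight (k : ℕ) (t : ℝ) (i : ℕ) : ℝ :=
  (if k ≤ i then 1 else 0) * if i = k then Real.exp t else 1

theorem tiltedWeight_nonneg (k : ℕ) (t : ℝ) (i : ℕ) : 0 ≤ tiltedWeight k t i := by
  unfold tiltedWeight
  split_ifs <;> positivity

theorem sum_exp_minimalBins (k n M : ℕ) (t : ℝ) :
    ∑ a ∈ coreAllocations k n M, Real.exp (t * minimalBins k a)
      = M.factorial * PowerSeries.coeff M (weightSeries (tiltedWeight k t) ^ n) := by
  rw [← sum_prod_weight, coreAllocations, Finset.sum_filter]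
  refine Finset.sum_congr rfl fun a _ => ?_
  simp only [tiltedWeight, Finset.prod_mul_distrib]
  rw [Finset.prod_boole, ← Finset.prod_filter, Finset.prod_const, ← Real.exp_nat_mul, mul_comm t]
  simp [minimalBins]

theorem card_minimalPoints_univ (k : ℕ) {n M : ℕ} (a : Fin M → Fin n) :
    (minimalPoints k a Finset.univ).card = k * minimalBins k a := by
  have h1 : ∀ i ∈ minimalPoints k a Finset.univ,
      a i ∈ Finset.univ.filter fun v => (Finset.univ.filter fun i => a i = v).card = k := by
    intro i hi
    exact Finset.mem_filter.2 ⟨Finset.mem_univ _, (Finset.mem_filter.1 hi).2⟩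
  rw [Finset.card_eq_sum_card_fiberwise h1, minimalBins, mul_comm, ← smul_eq_mul,
    ← Finset.sum_const]
  refine Finset.sum_congr rfl fun v hv => ?_
  have hv' := (Finset.mem_filter.1 hv).2
  rw [← hv']
  congr 1
  ext i
  simp only [minimalPoints, Finset.mem_filter, Finset.mem_univ, true_and]
  constructor
  · exact fun h => h.2
  · rintro rfl
    exact ⟨rfl, rfl⟩

theorem hasSum_coreSeries (k : ℕ) (x : ℝ) :
    HasSum (fun i => PowerSeries.coeff i (coreSeries k) * x ^ i) (expTail k x) := by
  have h1 : HasSum (fun i => PowerSeries.coeff (i + k) (coreSeries k) * x ^ (i + k))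
      (expTail k x - 0) := by
    rw [sub_zero]
    refine (hasSum_expTail k x).congr_fun fun i => ?_
    rw [coeff_coreSeries, if_pos (Nat.le_add_left _ _)]
    ring
  have h2 : ∑ i ∈ Finset.range k, PowerSeries.coeff i (coreSeries k) * x ^ i = 0 := by
    refine Finset.sum_eq_zero fun i hi => ?_
    rw [coeff_coreSeries, if_neg (by simpa using hi)]
    simp
  rw [← h2] at h1
  exact (hasSum_nat_add_iff' k).1 h1

theorem hasSum_tiltedWeight (k : ℕ) (t x : ℝ) :
    HasSum (fun i => PowerSeries.coeff i (weightSeries (tiltedWeight k t)) * x ^ i)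
      (expTail k x + (Real.exp t - 1) * (x ^ k / (k.factorial : ℝ))) := by
  have h1 := (hasSum_coreSeries k x).add
    (hasSum_ite_eq k ((Real.exp t - 1) * (x ^ k / (k.factorial : ℝ))))
  refine h1.congr_fun fun i => ?_
  rw [coeff_weightSeries, coeff_coreSeries, tiltedWeight]
  by_cases h : i = k
  · subst h
    simp only [le_refl, if_true]
    ring
  · simp [h]

/-- The exponential upper tail bound for the number of bins with exactly `k` points. -/
theorem card_filter_minimalBins_le (k n M : ℕ) {t x : ℝ} (ht : 0 ≤ t) (hx : 0 < x) (s : ℝ) :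
    (((coreAllocations k n M).filter fun a => s ≤ minimalBins k a).card : ℝ) * Real.exp (t * s)
      ≤ M.factorial *
        ((expTail k x + (Real.exp t - 1) * (x ^ k / (k.factorial : ℝ))) ^ n / x ^ M) := by
  have h1 : (((coreAllocations k n M).filter fun a => s ≤ minimalBins k a).card : ℝ)
      * Real.exp (t * s) ≤ ∑ a ∈ coreAllocations k n M, Real.exp (t * minimalBins k a) := by
    rw [← nsmul_eq_mul, ← Finset.sum_const, Finset.sum_filter]
    refine Finset.sum_le_sum fun a _ => ?_
    split_ifs with h
    · gcongr
    · positivity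
  rw [sum_exp_minimalBins] at h1
  refine h1.trans (mul_le_mul_of_nonneg_left ?_ (by positivity))
  have h2 : ∀ i, 0 ≤ PowerSeries.coeff i (weightSeries (tiltedWeight k t)) := fun i => by
    rw [coeff_weightSeries]
    exact div_nonneg (tiltedWeight_nonneg k t i) (by positivity)
  have h3 := hasSum_coeff_pow (hasSum_tiltedWeight k t x) n
  -- For nonnegative coefficients, each single term of the series at `x` is at most its value.
  rw [le_div_iff₀ (by positivity)]
  exact le_hasSum h3 M fun i _ => mul_nonneg (coeff_pow_nonneg h2 n i) (by positivity)

/-! ### Concentration of the number of minimal bins -/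

theorem exp_sub_one_sub_le (y : ℝ) : Real.exp y - 1 - y ≤ y ^ 2 * Real.exp |y| := by
  have h1 := Real.add_one_le_exp (-y)
  have h2 := Real.exp_pos y
  have h3 : Real.exp y * Real.exp (-y) = 1 := by rw [← Real.exp_add]; simp
  have h4 : Real.exp y - 1 ≤ y * Real.exp y := by nlinarith
  rcases le_total 0 y with h | h
  · rw [abs_of_nonneg h]
    nlinarith
  · have h5 := Real.add_one_le_exp y
    have h6 : 1 ≤ Real.exp |y| := Real.one_le_exp (abs_nonneg y)
    have h7 : Real.exp y - 1 - y ≤ y ^ 2 := by nlinarith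
    nlinarith [sq_nonneg y]

theorem hasSum_id_mul_coreSeries (k : ℕ) (x : ℝ) :
    HasSum (fun i : ℕ => (i : ℝ) * (PowerSeries.coeff i (coreSeries (k + 1)) * x ^ i))
      (x * expTail k x) := by
  rw [← hasSum_nat_add_iff' 1]
  simp only [Finset.sum_range_one, Nat.cast_zero, zero_mul, sub_zero]
  refine ((hasSum_coreSeries k x).mul_left x).congr_fun fun i => ?_
  rw [coeff_coreSeries, coeff_coreSeries, ← succ_div_factorial_succ i]
  simp only [Nat.add_le_add_iff_right]
  push_cast
  ring

/-- A second order bound for `f_k(x e^t)`. -/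
theorem expTail_mul_exp_le (k : ℕ) {x t : ℝ} (hx : 0 < x) (ht : |t| ≤ 1) :
    expTail (k + 1) (x * Real.exp t)
      ≤ expTail (k + 1) x + t * (x * expTail k x) + t ^ 2 * Real.exp (x * Real.exp 3) := by
  have hexp : HasSum (fun i : ℕ => (x * Real.exp 3) ^ i / (i.factorial : ℝ))
      (Real.exp (x * Real.exp 3)) := by
    have := hasSum_expTail 0 (x * Real.exp 3)
    simpa [expTail] using this
  have h := ((hasSum_coreSeries (k + 1) x).add ((hasSum_id_mul_coreSeries k x).mul_left t)).add
    (hexp.mul_left (t ^ 2))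
  refine hasSum_le (fun i => ?_) (hasSum_coreSeries (k + 1) (x * Real.exp t)) h
  set b := PowerSeries.coeff i (coreSeries (k + 1)) with hb
  have hb0 : 0 ≤ b := coeff_coreSeries_nonneg _ _
  have hb1 : b ≤ 1 / (i.factorial : ℝ) := by
    rw [hb, coeff_coreSeries]
    gcongr
    split_ifs <;> norm_num
  have h1 := exp_sub_one_sub_le (t * i)
  have hi : (0 : ℝ) ≤ i := by positivity
  have h2 : |t * i| ≤ i := by
    rw [abs_mul, abs_of_nonneg hi]
    nlinarith
  have h3 : (i : ℝ) ≤ Real.exp i := by linarith [Real.add_one_le_exp (i : ℝ)]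
  -- The 3 in the exponent: i² ≤ exp(2i), and exp|ti| ≤ exp(i).
  have h4 : (t * i) ^ 2 * Real.exp |t * i| ≤ t ^ 2 * Real.exp 3 ^ i := by
    calc (t * i) ^ 2 * Real.exp |t * i| ≤ t ^ 2 * Real.exp i ^ 2 * Real.exp i := by
          rw [mul_pow]
          gcongr
      _ = t ^ 2 * Real.exp 3 ^ i := by
          rw [mul_assoc, ← pow_succ, ← Real.exp_nat_mul, ← Real.exp_nat_mul]
          congr 2
          push_cast
          ring
  have h5 : (x * Real.exp t) ^ i = x ^ i * Real.exp (t * i) := by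
    rw [mul_pow, ← Real.exp_nat_mul, mul_comm t]
  have h6 : Real.exp (t * i) ≤ 1 + t * i + t ^ 2 * Real.exp 3 ^ i := by linarith
  have hxi : 0 < x ^ i := by positivity
  calc b * (x * Real.exp t) ^ i ≤ b * (x ^ i * (1 + t * i + t ^ 2 * Real.exp 3 ^ i)) := by
        rw [h5]
        gcongr
    _ = b * x ^ i + t * (i * (b * x ^ i)) + b * (t ^ 2 * (x * Real.exp 3) ^ i) := by
        rw [mul_pow]
        ring
    _ ≤ b * x ^ i + t * (i * (b * x ^ i))
          + 1 / (i.factorial : ℝ) * (t ^ 2 * (x * Real.exp 3) ^ i) := by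
        gcongr
    _ = _ := by ring

/-- The law of the total number of points in `n` independent truncated Poisson bins. -/
noncomputable def totalLaw (k n : ℕ) (x : ℝ) (j : ℕ) : ℝ :=
  PowerSeries.coeff j (coreSeries k ^ n) * x ^ j / expTail k x ^ n

theorem totalLaw_nonneg (k n : ℕ) {x : ℝ} (hx : 0 < x) (j : ℕ) : 0 ≤ totalLaw k n x j := by
  have h1 := coeff_pow_nonneg (coeff_coreSeries_nonneg k) n j
  have h2 := expTail_pos k hx
  unfold totalLaw
  positivity

theorem hasSum_totalLaw (k n : ℕ) {x : ℝ} (hx : 0 < x) : HasSum (totalLaw k n x) 1 := by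
  have h := (hasSum_coeff_pow (hasSum_coreSeries k x) n).div_const (expTail k x ^ n)
  rwa [div_self (pow_pos (expTail_pos k hx) n).ne'] at h

theorem hasSum_totalLaw_exp (k n : ℕ) (x t : ℝ) :
    HasSum (fun j : ℕ => totalLaw k n x j * Real.exp (t * j))
      (expTail k (x * Real.exp t) ^ n / expTail k x ^ n) := by
  refine ((hasSum_coeff_pow (hasSum_coreSeries k (x * Real.exp t)) n).div_const
    (expTail k x ^ n)).congr_fun fun j => ?_
  rw [totalLaw, mul_pow, ← Real.exp_nat_mul, mul_comm t]
  ring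

/-- The centred moment generating function of the total number of points is subgaussian. -/
theorem totalLaw_mgf_le (k n M : ℕ) {x t E : ℝ} (hx : 0 < x) (ht : |t| ≤ 1)
    (hM : (M : ℝ) * expTail (k + 1) x = n * (x * expTail k x))
    (hE : Real.exp (x * Real.exp 3) / expTail (k + 1) x ≤ E) :
    expTail (k + 1) (x * Real.exp t) ^ n / expTail (k + 1) x ^ n
      ≤ Real.exp (t * M) * Real.exp (n * t ^ 2 * E) := by
  have hf := expTail_pos (k + 1) hx
  have h1 : expTail (k + 1) (x * Real.exp t) / expTail (k + 1) x
      ≤ Real.exp (t * (x * expTail k x / expTail (k + 1) x) + t ^ 2 * E) := by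
    have h2 := expTail_mul_exp_le k hx ht
    have h3 : expTail (k + 1) (x * Real.exp t) / expTail (k + 1) x
        ≤ 1 + t * (x * expTail k x / expTail (k + 1) x)
          + t ^ 2 * (Real.exp (x * Real.exp 3) / expTail (k + 1) x) := by
      rw [div_le_iff₀ hf]
      refine h2.trans (le_of_eq ?_)
      field_simp
    have h4 := Real.add_one_le_exp (t * (x * expTail k x / expTail (k + 1) x) + t ^ 2 * E)
    have h5 := mul_le_mul_of_nonneg_left hE (sq_nonneg t)
    linarith
  have h0 : 0 ≤ expTail (k + 1) (x * Real.exp t) / expTail (k + 1) x :=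
    div_nonneg (expTail_pos _ (by positivity)).le hf.le
  rw [← div_pow]
  refine (pow_le_pow_left₀ h0 h1 n).trans (le_of_eq ?_)
  rw [← Real.exp_nat_mul, ← Real.exp_add]
  congr 1
  have h6 : (M : ℝ) = n * (x * expTail k x) / expTail (k + 1) x := by
    rw [← hM]
    field_simp
  rw [h6]
  ring

theorem totalLaw_succ_le (k n j : ℕ) {x ε L : ℝ} (hn : 1 ≤ n) (hx : 0 < x) (hε : 0 < ε)
    (hj : (k + ε) * n ≤ j + 1) (hL : x / ε ≤ Real.exp L) :
    totalLaw k n x (j + 1) ≤ Real.exp L * totalLaw k n x j := by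
  have h1 := sub_mul_coeff_coreSeries_pow_le (k := k) n j
  have h2 : PowerSeries.coeff (j + 1) (coreSeries k ^ n)
      ≤ PowerSeries.coeff j (coreSeries k ^ n) / ε := by
    have hn' : (0 : ℝ) < n := by exact_mod_cast hn
    have h3 := coeff_pow_nonneg (coeff_coreSeries_nonneg k) n (j + 1)
    rw [le_div_iff₀ hε]
    refine le_of_mul_le_mul_left ?_ hn'
    nlinarith
  have h3 := totalLaw_nonneg k n hx j
  have hf := expTail_pos k hx
  calc totalLaw k n x (j + 1) ≤ PowerSeries.coeff j (coreSeries k ^ n) / ε * x ^ (j + 1)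
        / expTail k x ^ n := by unfold totalLaw; gcongr
    _ = x / ε * totalLaw k n x j := by unfold totalLaw; ring
    _ ≤ _ := by gcongr

theorem totalLaw_le_succ (k n j : ℕ) {x B L : ℝ} (hn : 1 ≤ n) (hx : 0 < x)
    (hj : (j : ℝ) + 1 ≤ B * n) (hL : B / x ≤ Real.exp L) :
    totalLaw k n x j ≤ Real.exp L * totalLaw k n x (j + 1) := by
  have h1 := mul_coeff_coreSeries_pow_le k n j
  have h2 : PowerSeries.coeff j (coreSeries k ^ n)
      ≤ B * PowerSeries.coeff (j + 1) (coreSeries k ^ n) := by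
    have hn' : (0 : ℝ) < n := by exact_mod_cast hn
    have h3 := coeff_pow_nonneg (coeff_coreSeries_nonneg k) n (j + 1)
    refine le_of_mul_le_mul_left ?_ hn'
    nlinarith
  have h3 := totalLaw_nonneg k n hx (j + 1)
  have hf := expTail_pos k hx
  calc totalLaw k n x j ≤ B * PowerSeries.coeff (j + 1) (coreSeries k ^ n) * x ^ j
        / expTail k x ^ n := by unfold totalLaw; gcongr
    _ = B / x * totalLaw k n x (j + 1) := by
        unfold totalLaw
        field_simp
        ring
    _ ≤ _ := by gcongr

/-- Iterating the two ratio bounds away from `M`. Going up needs the total to exceed kn by εn, going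
down needs it to be at most Bn. -/
theorem totalLaw_le_exp_mul (k n M : ℕ) {x ε B L : ℝ} (hn : 1 ≤ n) (hx : 0 < x) (hε : 0 < ε)
    (hM : (k + ε) * n ≤ M) (hB : (M : ℝ) ≤ B * n) (hL : x / ε ≤ Real.exp L)
    (hL' : B / x ≤ Real.exp L) {r j : ℕ} (hj : j ∈ Finset.Icc (M - r) (M + r)) (hL0 : 0 ≤ L) :
    totalLaw k n x j ≤ Real.exp (L * r) * totalLaw k n x M := by
  have hup : ∀ i : ℕ, totalLaw k n x (M + i) ≤ Real.exp (L * i) * totalLaw k n x M := by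
    intro i
    induction i with
    | zero => simp
    | succ i ih =>
      have h1 := totalLaw_succ_le k n (M + i) hn hx hε (by push_cast; nlinarith) hL
      refine h1.trans ((mul_le_mul_of_nonneg_left ih (Real.exp_pos L).le).trans (le_of_eq ?_))
      rw [← mul_assoc, ← Real.exp_add]
      push_cast
      ring_nf
  have hdown : ∀ i : ℕ, i ≤ M → totalLaw k n x (M - i) ≤ Real.exp (L * i) * totalLaw k n x M := by
    intro i
    induction i with
    | zero => simp
    | succ i ih =>
      intro hi
      have h2 : M - (i + 1) + 1 = M - i := by omega
      have h1 := totalLaw_le_succ k n (M - (i + 1)) hn hx (B := B) (L := L) (by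
        have : ((M - (i + 1) + 1 : ℕ) : ℝ) ≤ M := by exact_mod_cast (by omega)
        push_cast at this
        linarith) hL'
      rw [h2] at h1
      refine h1.trans ((mul_le_mul_of_nonneg_left (ih (by omega))
        (Real.exp_pos L).le).trans (le_of_eq ?_))
      rw [← mul_assoc, ← Real.exp_add]
      push_cast
      ring_nf
  have hmono : ∀ i : ℕ, i ≤ r → Real.exp (L * i) * totalLaw k n x M
      ≤ Real.exp (L * r) * totalLaw k n x M := by
    intro i hi
    have := totalLaw_nonneg k n hx M
    gcongr
  rw [Finset.mem_Icc] at hj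
  rcases le_total M j with h | h
  · obtain ⟨i, rfl⟩ := Nat.exists_eq_add_of_le h
    exact (hup i).trans (hmono i (by omega))
  · have h3 := hdown (M - j) (by omega)
    rw [show M - (M - j) = j by omega] at h3
    exact h3.trans (hmono _ (by omega))

/-- Chernoff's bound for the mass of a window around `M`. -/
theorem one_le_sum_Icc_add {a : ℕ → ℝ} {R t p p' : ℝ} {r : ℕ} (ha : ∀ j, 0 ≤ a j)
    (h1 : HasSum a 1) (hp : HasSum (fun j : ℕ => a j * Real.exp (t * j)) p)
    (hp' : HasSum (fun j : ℕ => a j * Real.exp (-t * j)) p') (M : ℕ) (ht : 0 ≤ t)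
    (hrt : R ≤ r * t) :
    1 ≤ ∑ j ∈ Finset.Icc (M - r) (M + r), a j + Real.exp (-R) * Real.exp (-(t * M)) * p
      + Real.exp (-R) * Real.exp (-(-t * M)) * p' := by
  set W := Finset.Icc (M - r) (M + r) with hW
  have hsumW : HasSum (fun j => if j ∈ W then a j else 0) (∑ j ∈ W, a j) := by
    have : HasSum (fun j => if j ∈ W then a j else 0) (∑ j ∈ W, if j ∈ W then a j else 0) :=
      hasSum_sum_of_ne_finset_zero fun j hj => if_neg hj
    rwa [Finset.sum_congr rfl fun j hj => if_pos hj] at this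
  -- Compared term by term: outside the window, one of the two exponential terms already dominates
  -- `a j`.
  refine hasSum_le (fun j => ?_) h1 ((hsumW.add (hp.mul_left _)).add (hp'.mul_left _))
  have haj := ha j
  have h2 : 0 ≤ Real.exp (-R) * Real.exp (-(t * M)) * (a j * Real.exp (t * j)) := by positivity
  have h3 : 0 ≤ Real.exp (-R) * Real.exp (-(-t * M)) * (a j * Real.exp (-t * j)) := by positivity
  by_cases hj : j ∈ W
  · rw [if_pos hj]
    linarith
  rw [if_neg hj, zero_add]
  rw [hW, Finset.mem_Icc, not_and_or, not_le, not_le] at hj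
  have key : ∀ u v : ℝ, R ≤ u + v → a j ≤ Real.exp (-R) * Real.exp u * (a j * Real.exp v) := by
    intro u v huv
    have h4 : 1 ≤ Real.exp (-R) * Real.exp u * Real.exp v := by
      rw [← Real.exp_add, ← Real.exp_add]
      exact Real.one_le_exp (by linarith)
    calc a j ≤ Real.exp (-R) * Real.exp u * Real.exp v * a j := le_mul_of_one_le_left haj h4
      _ = _ := by ring
  rcases hj with hj | hj
  · refine (key (-(-t * M)) (-t * j) ?_).trans (le_add_of_nonneg_left h2)
    have h4 : ((j + r : ℕ) : ℝ) ≤ M := by exact_mod_cast (by omega)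
    push_cast at h4
    nlinarith
  · refine (key (-(t * M)) (t * j) ?_).trans (le_add_of_nonneg_right h3)
    have h4 : ((M + r : ℕ) : ℝ) ≤ j := by exact_mod_cast hj.le
    push_cast at h4
    nlinarith

/-- The total number of points takes a value near its mean with a probability that is not
exponentially small in more than `√n`. -/
theorem exists_exp_neg_sqrt_le_totalLaw (k : ℕ) {x₀ B ε : ℝ} (hx₀ : 0 < x₀) (hε : 0 < ε) :
    ∃ C : ℝ, ∀ (n M : ℕ) (x : ℝ), 1 ≤ n → x₀ ≤ x → x ≤ B →
      (M : ℝ) * expTail (k + 1) x = n * (x * expTail k x) →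
      ((k + 1 : ℕ) + ε) * n ≤ M → (M : ℝ) ≤ B * n →
      Real.exp (-(C * √n)) ≤ totalLaw (k + 1) n x M := by
  set E : ℝ := Real.exp (B * Real.exp 3) / (x₀ ^ (k + 1) / ((k + 1).factorial : ℝ)) with hE
  set L : ℝ := |B / ε| + |B / x₀| with hL
  -- Chosen so that each tail has mass at most exp(E - R) ≤ exp(-4) ≤ 1/4, which leaves at least 1/2
  -- for the window.
  set R : ℝ := |E| + 4 with hR
  refine ⟨(L + 2) * (R + 1) + 1, fun n M x hn hx hxB hM hMε hMB => ?_⟩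
  have hx0 : 0 < x := hx₀.trans_le hx
  have hn' : (1 : ℝ) ≤ n := by exact_mod_cast hn
  have hs1 : 1 ≤ √(n : ℝ) := Real.one_le_sqrt.2 hn'
  have hs2 : √(n : ℝ) ^ 2 = n := Real.sq_sqrt (by positivity)
  have hL0 : 0 ≤ L := by positivity
  have hB : 0 < B := hx0.trans_le hxB
  have hexpL : L ≤ Real.exp L := by linarith [Real.add_one_le_exp L]
  have hL1 : x / ε ≤ Real.exp L := by
    have h1 : x / ε ≤ B / ε := by gcongr
    have h2 := le_abs_self (B / ε)
    have h3 := abs_nonneg (B / x₀)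
    linarith
  have hL2 : B / x ≤ Real.exp L := by
    have h1 : B / x ≤ B / x₀ := by gcongr
    have h2 := le_abs_self (B / x₀)
    have h3 := abs_nonneg (B / ε)
    linarith
  have hEx : Real.exp (x * Real.exp 3) / expTail (k + 1) x ≤ E := by
    have h1 : x₀ ^ (k + 1) / ((k + 1).factorial : ℝ) ≤ expTail (k + 1) x := by
      have h2 := expTail_succ (k + 1) x
      have h3 := expTail_pos (k + 1 + 1) hx0
      have h4 : x₀ ^ (k + 1) / ((k + 1).factorial : ℝ) ≤ x ^ (k + 1) / ((k + 1).factorial : ℝ) := by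
        gcongr
      linarith
    rw [hE]
    gcongr
  set r : ℕ := ⌈R * √n⌉₊ with hr
  have hR0 : 0 ≤ R := by positivity
  have hr1 : R * √n ≤ r := Nat.le_ceil _
  have hr2 : (r : ℝ) < R * √n + 1 := Nat.ceil_lt_add_one (by positivity)
  -- With this scale the quadratic term n t² E is just E, and a window of radius R√n suffices.
  set t : ℝ := (√n)⁻¹ with ht
  have ht0 : 0 < t := by positivity
  have ht1 : |t| ≤ 1 := by
    rw [abs_of_pos ht0]
    exact inv_le_one_of_one_le₀ hs1
  have ht2 : n * t ^ 2 * E = E := by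
    rw [ht, inv_pow, hs2]
    field_simp
  have hpos := totalLaw_mgf_le k n M hx0 ht1 hM hEx
  have hneg := totalLaw_mgf_le k n M (t := -t) hx0 (by rwa [abs_neg]) hM hEx
  rw [ht2] at hpos
  rw [neg_sq, ht2] at hneg
  set W := Finset.Icc (M - r) (M + r) with hW
  set c : ℝ := Real.exp (-R) with hc
  have hrt : R ≤ r * t := by
    rw [ht, ← div_eq_mul_inv, le_div_iff₀ (by positivity)]
    exact hr1
  have hle := one_le_sum_Icc_add (totalLaw_nonneg (k + 1) n hx0) (hasSum_totalLaw (k + 1) n hx0)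
    (hasSum_totalLaw_exp (k + 1) n x t) (hasSum_totalLaw_exp (k + 1) n x (-t)) M ht0.le hrt
  rw [← hW, ← hc] at hle
  have hcE : c * Real.exp E ≤ 1 / 4 := by
    rw [hc, ← Real.exp_add]
    have h1 : Real.exp (-R + E) ≤ Real.exp (-4) :=
      Real.exp_le_exp.2 (by linarith [le_abs_self E])
    have h2 : Real.exp (-4) ≤ 1 / 4 := by
      rw [Real.exp_neg, one_div]
      exact inv_anti₀ (by norm_num) (by linarith [Real.add_one_le_exp (4 : ℝ)])
    linarith
  have hbound : ∀ u P : ℝ, P ≤ Real.exp u * Real.exp E → c * Real.exp (-u) * P ≤ 1 / 4 := by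
    intro u P hP
    refine le_trans (mul_le_mul_of_nonneg_left hP (by positivity)) ?_
    have : Real.exp (-u) * Real.exp u = 1 := by rw [← Real.exp_add]; simp
    calc c * Real.exp (-u) * (Real.exp u * Real.exp E)
        = c * Real.exp E * (Real.exp (-u) * Real.exp u) := by ring
      _ ≤ 1 / 4 := by rw [this, mul_one]; exact hcE
  have h3 := hbound _ _ hpos
  have h4 := hbound _ _ hneg
  have h5 : ∑ j ∈ W, totalLaw (k + 1) n x j
      ≤ Real.exp (2 * r) * (Real.exp (L * r) * totalLaw (k + 1) n x M) := by
    have h6 : ∑ j ∈ W, totalLaw (k + 1) n x j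
        ≤ ∑ j ∈ W, Real.exp (L * r) * totalLaw (k + 1) n x M :=
      Finset.sum_le_sum fun j hj =>
        totalLaw_le_exp_mul (k + 1) n M hn hx0 hε hMε hMB hL1 hL2 hj hL0
    rw [Finset.sum_const, nsmul_eq_mul] at h6
    refine h6.trans (mul_le_mul_of_nonneg_right ?_
      (mul_nonneg (Real.exp_pos _).le (totalLaw_nonneg _ _ hx0 _)))
    have h7 : W.card ≤ 2 * r + 1 := by
      rw [hW, Nat.card_Icc]
      omega
    have h8 : (W.card : ℝ) ≤ 2 * r + 1 := by exact_mod_cast h7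
    linarith [Real.add_one_le_exp (2 * (r : ℝ))]
  have h9 : 1 / 2 ≤ Real.exp ((L + 2) * r) * totalLaw (k + 1) n x M := by
    rw [← mul_assoc, ← Real.exp_add, show 2 * (r : ℝ) + L * r = (L + 2) * r by ring] at h5
    linarith
  have h10 : Real.exp (-1) ≤ 1 / 2 := by
    rw [Real.exp_neg, one_div]
    exact inv_anti₀ (by norm_num) (by linarith [Real.add_one_le_exp (1 : ℝ)])
  have h11 : (L + 2) * r + 1 ≤ ((L + 2) * (R + 1) + 1) * √n := by
    have : (r : ℝ) ≤ (R + 1) * √n := by linarith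
    calc (L + 2) * r + 1 ≤ (L + 2) * ((R + 1) * √n) + √n := by gcongr
      _ = _ := by ring
  have h12 : Real.exp (-(((L + 2) * (R + 1) + 1) * √n)) ≤ Real.exp (-((L + 2) * r) + -1) :=
    Real.exp_le_exp.2 (by linarith)
  rw [Real.exp_add] at h12
  have h13 : Real.exp (-((L + 2) * r)) * Real.exp ((L + 2) * r) = 1 := by
    rw [← Real.exp_add]
    simp
  calc _ ≤ _ := h12
    _ ≤ Real.exp (-((L + 2) * r)) * (1 / 2) := by gcongr
    _ ≤ Real.exp (-((L + 2) * r)) * (Real.exp ((L + 2) * r) * totalLaw (k + 1) n x M) := by gcongr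
    _ = _ := by rw [← mul_assoc, h13, one_mul]

/-- The number of bins with exactly `k` points exceeds its mean by `η n` only with small
probability. -/
theorem card_filter_minimalBins_le_exp (k n M : ℕ) {x η C : ℝ} (hx : 0 < x) (hη : 0 ≤ η)
    (hη2 : η ≤ 2) (hC : Real.exp (-(C * √n)) ≤ totalLaw k n x M) :
    (((coreAllocations k n M).filter fun a =>
        (x ^ k / (k.factorial : ℝ) / expTail k x + η) * n ≤ minimalBins k a).card : ℝ)
      ≤ (coreAllocations k n M).card * Real.exp (C * √n - n * η ^ 2 / 4) := by
  have hf := expTail_pos k hx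
  set q : ℝ := x ^ k / (k.factorial : ℝ) / expTail k x with hq
  have hq0 : 0 ≤ q := by positivity
  have hq1 : q ≤ 1 := by
    rw [hq, div_le_one hf]
    linarith [expTail_succ k x, expTail_pos (k + 1) hx]
  -- The exponent n(qt + t²) - t(q + η)n is minimal at t = η/2, with value -nη²/4; `η ≤ 2` keeps t
  -- in the range of the quadratic bound for exp.
  have h1 := card_filter_minimalBins_le k n M (t := η / 2) (by positivity) hx ((q + η) * n)
  set A := (((coreAllocations k n M).filter fun a => (q + η) * n ≤ minimalBins k a).card : ℝ)
    with hA
  have h2 : (expTail k x + (Real.exp (η / 2) - 1) * (x ^ k / (k.factorial : ℝ))) ^ n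
      ≤ expTail k x ^ n * Real.exp (n * (q * (η / 2) + (η / 2) ^ 2)) := by
    have h3 : expTail k x + (Real.exp (η / 2) - 1) * (x ^ k / (k.factorial : ℝ))
        = expTail k x * (1 + (Real.exp (η / 2) - 1) * q) := by
      rw [hq]
      field_simp
    have hexp0 : 1 ≤ Real.exp (η / 2) := Real.one_le_exp (by positivity)
    have h4 : 1 + (Real.exp (η / 2) - 1) * q ≤ Real.exp (q * (η / 2) + (η / 2) ^ 2) := by
      have h5 : Real.exp (η / 2) - 1 - η / 2 ≤ (η / 2) ^ 2 := by
        have := Real.abs_exp_sub_one_sub_id_le (x := η / 2) (by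
          rw [abs_of_nonneg (by positivity)]
          linarith)
        exact (le_abs_self _).trans this
      have h6 := Real.add_one_le_exp (q * (η / 2) + (η / 2) ^ 2)
      nlinarith [sq_nonneg (η / 2)]
    rw [h3, mul_pow, Real.exp_nat_mul]
    have h7 : 0 ≤ 1 + (Real.exp (η / 2) - 1) * q := by nlinarith
    gcongr
  -- Conditioning on the total: the count is the unconditioned normalisation times the probability
  -- of total `M`, so dividing by that probability costs exp(C√n).
  have h8 : (M.factorial : ℝ) * (expTail k x ^ n / x ^ M) * totalLaw k n x M
      = (coreAllocations k n M).card := by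
    rw [card_coreAllocations, totalLaw]
    field_simp
  have h9 : (M.factorial : ℝ) * (expTail k x ^ n / x ^ M)
      ≤ (coreAllocations k n M).card * Real.exp (C * √n) := by
    rw [← h8, mul_assoc]
    have h10 : 1 ≤ totalLaw k n x M * Real.exp (C * √n) := by
      have := mul_le_mul_of_nonneg_right hC (Real.exp_pos (C * √n)).le
      rwa [← Real.exp_add, neg_add_cancel, Real.exp_zero] at this
    exact le_mul_of_one_le_right (by positivity) h10
  have h11 : A * Real.exp (η / 2 * ((q + η) * n)) ≤ (coreAllocations k n M).card
      * Real.exp (C * √n) * Real.exp (n * (q * (η / 2) + (η / 2) ^ 2)) := by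
    calc _ ≤ _ := h1
      _ ≤ (M.factorial : ℝ) * ((expTail k x ^ n
          * Real.exp (n * (q * (η / 2) + (η / 2) ^ 2))) / x ^ M) := by gcongr
      _ = (M.factorial : ℝ) * (expTail k x ^ n / x ^ M)
          * Real.exp (n * (q * (η / 2) + (η / 2) ^ 2)) := by ring
      _ ≤ _ := by gcongr
  have h12 : A = A * Real.exp (η / 2 * ((q + η) * n)) * Real.exp (-(η / 2 * ((q + η) * n))) := by
    rw [mul_assoc, ← Real.exp_add, add_neg_cancel, Real.exp_zero, mul_one]
  rw [h12]
  refine (mul_le_mul_of_nonneg_right h11 (Real.exp_pos _).le).trans (le_of_eq ?_)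
  rw [mul_assoc, mul_assoc, ← Real.exp_add, ← Real.exp_add]
  congr 2
  ring

/-! ### The subcritical regime -/

/-- The vanishing of the derivative of `coreFun` at its minimum, rearranged. -/
theorem expTail_criticalPoint_div (j : ℕ) (hj : 1 ≤ j) :
    expTail (j + 1) (criticalPoint (j + 2)) / criticalPoint (j + 2) ^ (j + 1)
      = 1 / (j.factorial : ℝ) := by
  have hk : 3 ≤ j + 2 := by omega
  obtain ⟨hx, hxc⟩ := criticalPoint_spec hk
  set x := criticalPoint (j + 2)
  have hloc : IsLocalMin (coreFun (j + 2)) x := by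
    filter_upwards [lt_mem_nhds hx] with y hy
    rw [hxc]
    refine csInf_le ⟨0, ?_⟩ ⟨y, hy, rfl⟩
    rintro _ ⟨z, hz, rfl⟩
    exact (le_of_lt hz).trans (le_coreFun _ hz)
  have hd := hloc.hasDerivAt_eq_zero (hasDerivAt_coreFun hk hx)
  have hpos := expTail_pos (j + 1) hx
  have hs := expTail_succ j x
  simp only [Nat.add_sub_cancel, show j + 2 - 1 = j + 1 by omega] at hd
  have hd' := (div_eq_zero_iff.1 hd).resolve_right (by positivity)
  rw [hs] at hd'
  have h5 : Real.exp x * (expTail (j + 1) x - x * (x ^ j / (j.factorial : ℝ))) = 0 := by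
    linarith
  have h6 := (mul_eq_zero.1 h5).resolve_left (Real.exp_pos x).ne'
  have h7 : expTail (j + 1) x = x ^ (j + 1) / (j.factorial : ℝ) := by
    rw [pow_succ, mul_comm (x ^ j) x, mul_div_assoc]
    linarith
  rw [h7]
  have : (j.factorial : ℝ) ≠ 0 := by positivity
  field_simp

/-- The mean of a Poisson variable of parameter `x` conditioned to be at least `k + 1`. -/
noncomputable def truncatedMean (k : ℕ) (x : ℝ) : ℝ :=
  x * expTail k x / expTail (k + 1) x

theorem truncatedMean_eq (k : ℕ) {x : ℝ} (hx : 0 < x) : truncatedMean k x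
    = x + (1 / (k.factorial : ℝ)) / (expTail (k + 1) x / x ^ (k + 1)) := by
  have h1 := expTail_pos (k + 1) hx
  rw [truncatedMean, expTail_succ k x]
  field_simp
  ring

/-- The excess of the truncated mean over x is a constant divided by an increasing function, hence
decreasing. -/
theorem truncatedMean_sub_le (k : ℕ) {x y : ℝ} (hx : 0 < x) (hxy : x ≤ y) :
    truncatedMean k y - truncatedMean k x ≤ y - x := by
  rw [truncatedMean_eq k hx, truncatedMean_eq k (hx.trans_le hxy)]
  have h1 : expTail (k + 1) x / x ^ (k + 1) ≤ expTail (k + 1) y / y ^ (k + 1) := by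
    rcases hxy.eq_or_lt with rfl | h
    · exact le_rfl
    · exact (expTail_div_lt (k + 1) hx h).le
  have h2 : 0 < expTail (k + 1) x / x ^ (k + 1) := div_pos (expTail_pos _ hx) (by positivity)
  have h3 : (1 / (k.factorial : ℝ)) / (expTail (k + 1) y / y ^ (k + 1))
      ≤ (1 / (k.factorial : ℝ)) / (expTail (k + 1) x / x ^ (k + 1)) := by gcongr
  linarith

/-- At the critical point this provides the gap ε = c_k' - k > 0 that the upward ratio bound
requires. -/
theorem lt_truncatedMean (k : ℕ) {x : ℝ} (hx : 0 < x) : ((k + 1 : ℕ) : ℝ) < truncatedMean k x := by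
  rw [truncatedMean, lt_div_iff₀ (expTail_pos _ hx)]
  refine hasSum_lt (i := k + 2) (fun i => ?_) ?_
    ((hasSum_coreSeries (k + 1) x).mul_left ((k + 1 : ℕ) : ℝ)) (hasSum_id_mul_coreSeries k x)
  · by_cases h : k + 1 ≤ i
    · have h1 := coeff_coreSeries_nonneg (k + 1) i
      have h2 : ((k + 1 : ℕ) : ℝ) ≤ i := by exact_mod_cast h
      exact mul_le_mul_of_nonneg_right h2 (by positivity)
    · simp [coeff_coreSeries, h]
  · have h1 : 0 < PowerSeries.coeff (k + 2) (coreSeries (k + 1)) := by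
      rw [coeff_coreSeries, if_pos (by omega)]
      positivity
    have h2 : ((k + 1 : ℕ) : ℝ) < ((k + 2 : ℕ) : ℝ) := by exact_mod_cast Nat.lt_succ_self _
    exact mul_lt_mul_of_pos_right h2 (by positivity)

theorem le_truncatedMean (k : ℕ) {x : ℝ} (hx : 0 < x) : x ≤ truncatedMean k x := by
  have := expTail_pos (k + 1) hx
  rw [truncatedMean_eq k hx]
  have : 0 ≤ (1 / (k.factorial : ℝ)) / (expTail (k + 1) x / x ^ (k + 1)) := by positivity
  linarith

theorem continuous_expTail (k : ℕ) : Continuous (expTail k) := by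
  unfold expTail
  fun_prop

theorem exists_truncatedMean_eq (k : ℕ) {x₀ t : ℝ} (hx₀ : 0 < x₀) (ht : truncatedMean k x₀ ≤ t) :
    ∃ x, x₀ ≤ x ∧ x ≤ t ∧ truncatedMean k x = t := by
  have h1 : x₀ ≤ t := (le_truncatedMean k hx₀).trans ht
  have hc : ContinuousOn (truncatedMean k) (Set.Icc x₀ t) := by
    refine ContinuousOn.div ?_ (continuous_expTail _).continuousOn fun x hx =>
      (expTail_pos _ (hx₀.trans_le hx.1)).ne'
    exact (continuous_id.mul (continuous_expTail k)).continuousOn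
  obtain ⟨x, hx, hxt⟩ := intermediate_value_Icc h1 hc ⟨ht, le_truncatedMean k (hx₀.trans_le h1)⟩
  exact ⟨x, hx.1, hx.2, hxt⟩

/-- Above the critical degree, the expected number of new light vertices per deletion is smaller
than one by at least a multiple of the distance to the critical degree. -/
theorem exists_subcritical (j : ℕ) (hj : 1 ≤ j) (C₀ : ℝ) :
    ∃ c₁ : ℝ, 0 < c₁ ∧ ∀ t : ℝ, criticalDegree (j + 2) ≤ t → t ≤ C₀ →
      ∃ x, criticalPoint (j + 2) ≤ x ∧ x ≤ C₀ ∧ truncatedMean (j + 1) x = t ∧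
        (j + 2 : ℝ) * (j + 1) * (x ^ (j + 2) / ((j + 2).factorial : ℝ) / expTail (j + 2) x)
          ≤ t * (1 - c₁ * (t - criticalDegree (j + 2))) := by
  have hμ := (criticalPoint_spec (k := j + 2) (by omega)).1
  have hcrit := expTail_criticalPoint_div j hj
  set μ := criticalPoint (j + 2) with hμdef
  have hd : criticalDegree (j + 2) = truncatedMean (j + 1) μ := rfl
  rw [hd]
  by_cases hμC : μ ≤ C₀
  swap
  · exact ⟨1, one_pos, fun t h1 h2 =>
      absurd (((le_truncatedMean (j + 1) hμ).trans h1).trans h2) hμC⟩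
  have hC₀ : 0 < C₀ := hμ.trans_le hμC
  set g : ℝ → ℝ := fun x => expTail (j + 1) x / x ^ (j + 1) with hg
  have hgpos : ∀ x, 0 < x → 0 < g x := fun x hx => div_pos (expTail_pos _ hx) (by positivity)
  -- The constant combines three bounds: t - c' ≤ x - μ, g(x) - g(μ) ≥ (x - μ)/(j+2)!, and g(x) ≤
  -- g(C₀).
  refine ⟨1 / ((j + 2).factorial * g C₀), by have := hgpos C₀ hC₀; positivity,
    fun t h1 h2 => ?_⟩
  obtain ⟨x, hx1, hx2, hxt⟩ := exists_truncatedMean_eq (j + 1) hμ h1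
  have hx : 0 < x := hμ.trans_le hx1
  refine ⟨x, hx1, hx2.trans h2, hxt, ?_⟩
  have hgx := hgpos x hx
  have hf1 := expTail_pos (j + 1) hx
  have hf2 := expTail_pos (j + 2) hx
  have h3 : (j + 2 : ℝ) * (j + 1) * (x ^ (j + 2) / ((j + 2).factorial : ℝ) / expTail (j + 2) x)
      = t * (g μ / g x) := by
    have h4 : g μ = 1 / (j.factorial : ℝ) := hcrit
    rw [← hxt, h4, truncatedMean, hg, Nat.factorial_succ, Nat.factorial_succ]
    push_cast
    field_simp
    ring
  -- Of the power series of g(x) - g(μ), whose terms are all nonnegative, only the linear one is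
  -- kept.
  have h5 : (x - μ) / ((j + 2).factorial : ℝ) ≤ g x - g μ := by
    have h6 := (hasSum_expTail_div (j + 1) hx).sub (hasSum_expTail_div (j + 1) hμ)
    have h7 := le_hasSum h6 1 fun i _ => by
      rw [sub_nonneg]
      gcongr
    refine le_trans (le_of_eq ?_) h7
    rw [pow_one, pow_one, ← sub_div, show 1 + (j + 1) = j + 2 by omega]
  have h8 : g x ≤ g C₀ := by
    rcases (hx2.trans h2).eq_or_lt with h | h
    · rw [h]
    · exact (expTail_div_lt (j + 1) hx h).le
  have ht : 0 ≤ t := hx.le.trans hx2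
  have h9 := truncatedMean_sub_le (j + 1) hμ hx1
  rw [hxt] at h9
  rw [h3]
  refine mul_le_mul_of_nonneg_left ?_ ht
  have h10 : (t - truncatedMean (j + 1) μ) / ((j + 2).factorial * g C₀) ≤ (g x - g μ) / g x := by
    calc (t - truncatedMean (j + 1) μ) / ((j + 2).factorial * g C₀)
        ≤ (x - μ) / ((j + 2).factorial * g C₀) := by
          have := hgpos C₀ hC₀
          gcongr
      _ = (x - μ) / ((j + 2).factorial : ℝ) / g C₀ := by rw [div_div]
      _ ≤ (x - μ) / ((j + 2).factorial : ℝ) / g x := by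
          have : 0 ≤ (x - μ) / ((j + 2).factorial : ℝ) :=
            div_nonneg (sub_nonneg.2 hx1) (by positivity)
          gcongr
      _ ≤ _ := by gcongr
  rw [sub_div (g x) (g μ) (g x), div_self hgx.ne'] at h10
  rw [one_div_mul_eq_div]
  linarith

/-! ### The probability that many vertices are lost -/

theorem swapInvariant_filter_coreAllocations (k n M : ℕ) (s : ℝ) :
    SwapInvariant ((coreAllocations k n M).filter fun a => (minimalBins k a : ℝ) < s)
      Finset.univ := by
  intro a ha i _ j _
  have hcard : ∀ v, (Finset.univ.filter fun x => (a ∘ Equiv.swap i j) x = v).card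
      = (Finset.univ.filter fun x => a x = v).card := by
    intro v
    have : (Finset.univ.filter fun x => (a ∘ Equiv.swap i j) x = v)
        = (Finset.univ.filter fun x => a x = v).map (Equiv.swap i j).toEmbedding := by
      ext x
      simp [Finset.mem_map_equiv]
    rw [this, Finset.card_map]
  have hbins : minimalBins k (a ∘ Equiv.swap i j) = minimalBins k a := by
    unfold minimalBins
    simp only [hcard]
  obtain ⟨ha1, ha2⟩ := Finset.mem_filter.1 ha
  refine Finset.mem_filter.2 ⟨Finset.mem_filter.2 ⟨Finset.mem_univ _, fun v => ?_⟩, ?_⟩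
  · rw [hcard]
    exact (Finset.mem_filter.1 ha1).2 v
  · rwa [hbins]

theorem coe_coreAllocations (k n m : ℕ) :
    ((coreAllocations k n (2 * m) : Finset (Fin (2 * m) → Fin n)) : Set (Fin (2 * m) → Fin n))
      = allocations k n m := by
  ext a
  simp only [coreAllocations, allocations, Finset.coe_filter, Finset.mem_univ, true_and,
    Set.mem_ofPred_eq]
  refine forall_congr' fun v => ?_
  rw [← Finset.coe_filter_univ, Set.ncard_coe_finset]

/-- The bound holds for every fixed edge, so it survives averaging over the edge. Neither factor
need be a probability measure: both vanish on empty sample spaces, and total mass at most one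
suffices. -/
theorem allocationLaw_le {k n m : ℕ} {ε : ℝ} (hε : 0 ≤ ε)
    (S : Set ((Fin (2 * m) → Fin n) × Fin m)) (T : Fin m → Finset (Fin (2 * m) → Fin n))
    (hS : ∀ a e, a ∈ allocations k n m → (a, e) ∈ S → a ∈ T e)
    (hT : ∀ e, ((T e).card : ℝ) ≤ ε * (coreAllocations k n (2 * m)).card) :
    allocationLaw k n m S ≤ ENNReal.ofReal ε := by
  classical
  rw [allocationLaw, ← coe_coreAllocations]
  have hSm : MeasurableSet S := S.toFinite.measurableSet
  rw [Measure.prod_apply_symm hSm]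
  have hb : ∀ e : Fin m, uniformOn (coreAllocations k n (2 * m) : Set (Fin (2 * m) → Fin n))
      ((fun a => (a, e)) ⁻¹' S) ≤ ENNReal.ofReal ε := by
    intro e
    have h1 : ((fun a => (a, e)) ⁻¹' S) =
        ((Finset.univ.filter fun a => (a, e) ∈ S : Finset (Fin (2 * m) → Fin n)) : Set _) := by
      ext a
      simp
    rw [h1, uniformOn_apply_finset]
    refine ENNReal.div_le_of_le_mul ?_
    have h2 : (coreAllocations k n (2 * m) ∩ Finset.univ.filter fun a => (a, e) ∈ S) ⊆ T e := by
      intro a ha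
      rw [Finset.mem_inter, Finset.mem_filter] at ha
      refine hS a e ?_ ha.2.2
      rw [← coe_coreAllocations]
      exact ha.1
    have h3 : ((coreAllocations k n (2 * m) ∩ Finset.univ.filter fun a => (a, e) ∈ S).card : ℝ)
        ≤ ε * (coreAllocations k n (2 * m)).card :=
      le_trans (by exact_mod_cast Finset.card_le_card h2) (hT e)
    have h4 := ENNReal.ofReal_le_ofReal h3
    rwa [ENNReal.ofReal_mul hε, ENNReal.ofReal_natCast, ENNReal.ofReal_natCast] at h4
  calc _ ≤ ∫⁻ _ : Fin m, ENNReal.ofReal ε ∂uniformOn Set.univ := lintegral_mono hb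
    _ = ENNReal.ofReal ε * uniformOn Set.univ Set.univ := lintegral_const _
    _ ≤ ENNReal.ofReal ε * 1 := by
        gcongr
        exact prob_le_one
    _ = _ := mul_one _

/-- A bound for the probability that at least `h` vertices are lost, for fixed `n`. -/
theorem allocationLaw_lostVertices_le {k n m : ℕ} (hk : 1 ≤ k) {δ η x C h : ℝ} (hδ : 0 < δ)
    (hδ1 : δ ≤ 1) (hx : 0 < x) (hη : 0 ≤ η) (hη2 : η ≤ 2) (hh : 0 < h)
    (hC : Real.exp (-(C * √n)) ≤ totalLaw k n x (2 * m))
    (hsub : (k : ℝ) * (k - 1) * (x ^ k / (k.factorial : ℝ) / expTail k x + η) * n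
      + (k : ℝ) ^ 2 * (h + 1) ≤ (1 - δ) * (2 * m)) :
    allocationLaw k n m {p | h ≤ (lostVertices k (allocationGraph p.1) p.2 : ℝ)}
      ≤ ENNReal.ofReal (Real.exp (C * √n - n * η ^ 2 / 4) + 2 / (δ * h)) := by
  classical
  set s : ℝ := (x ^ k / (k.factorial : ℝ) / expTail k x + η) * n with hs
  set A := coreAllocations k n (2 * m) with hA
  set F := A.filter fun a => (minimalBins k a : ℝ) < s with hF
  -- The cap on the pruning time; rounding up is what the `h + 1` in `hsub` pays for.
  set N := ⌈h⌉₊ with hN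
  have hNh : h ≤ N := Nat.le_ceil h
  have hN1 : (N : ℝ) ≤ h + 1 := (Nat.ceil_lt_add_one hh.le).le
  have hk' : (1 : ℝ) ≤ k := by exact_mod_cast hk
  refine allocationLaw_le (by positivity) _ (fun e => (A.filter fun a => s ≤ minimalBins k a) ∪
    F.filter fun a => N ≤ lostVertices k (allocationGraph a) e) ?_ ?_
  · intro a e ha hS
    rw [← coe_coreAllocations] at ha
    have ha : a ∈ A := ha
    have h1 : N ≤ lostVertices k (allocationGraph a) e := Nat.ceil_le.2 hS
    rw [Finset.mem_union, Finset.mem_filter, Finset.mem_filter, Finset.mem_filter]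
    rcases le_or_gt s (minimalBins k a) with h2 | h2
    · exact Or.inl ⟨ha, h2⟩
    · exact Or.inr ⟨⟨ha, h2⟩, h1⟩
  · intro e
    have h1 := card_filter_minimalBins_le_exp k n (2 * m) hx hη hη2 hC
    have h2 := card_filter_lostVertices_mul_le (N := N) hk hδ hδ1 F
      (swapInvariant_filter_coreAllocations k n (2 * m) s)
      (fun a ha => by
        rw [← coe_coreAllocations]
        exact (Finset.mem_filter.1 ha).1)
      (fun a ha => by
        have h3 := (Finset.mem_filter.1 ha).2.le
        rw [card_minimalPoints_univ]
        push_cast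
        have h4 : (k : ℝ) * (k - 1) * minimalBins k a ≤ (k : ℝ) * (k - 1) * s :=
          mul_le_mul_of_nonneg_left h3 (mul_nonneg (by positivity) (by linarith))
        have h5 : (k : ℝ) ^ 2 * N ≤ (k : ℝ) ^ 2 * (h + 1) := by gcongr
        have h6 : (k : ℝ) * (k - 1) * s = (k : ℝ) * (k - 1)
          * (x ^ k / (k.factorial : ℝ) / expTail k x + η) * n := by rw [hs]; ring
        linarith) e
    have h7 : ((F.filter fun a => N ≤ lostVertices k (allocationGraph a) e).card : ℝ)
        ≤ A.card * (2 / (δ * h)) := by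
      set y := ((F.filter fun a => N ≤ lostVertices k (allocationGraph a) e).card : ℝ)
      have h8 : y * h ≤ A.card * 2 / δ := by
        calc y * h ≤ y * N := by gcongr
          _ ≤ F.card * 2 / δ := h2
          _ ≤ A.card * 2 / δ := by
              gcongr
              exact Finset.filter_subset _ _
      calc y = y * h / h := by field_simp
        _ ≤ A.card * 2 / δ / h := by gcongr
        _ = _ := by field_simp
    have h9 : ∀ B D : Finset (Fin (2 * m) → Fin n), ((B ∪ D).card : ℝ) ≤ B.card + D.card :=
      fun B D => by exact_mod_cast Finset.card_union_le B D
    refine (h9 _ _).trans ?_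
    rw [add_mul, mul_comm _ (A.card : ℝ), mul_comm _ (A.card : ℝ)]
    exact add_le_add h1 h7

/-! ### Rates and limits -/

theorem tendsto_div_atTop_of_isLittleO {u v : ℕ → ℝ} (h : u =o[atTop] v)
    (hu : ∀ᶠ n in atTop, 0 < u n) (hv : ∀ᶠ n in atTop, 0 < v n) :
    Tendsto (fun n => v n / u n) atTop atTop := by
  have h1 : Tendsto (fun n => u n / v n) atTop (𝓝[>] 0) := by
    refine tendsto_nhdsWithin_iff.2 ⟨h.tendsto_div_nhds_zero, ?_⟩
    filter_upwards [hu, hv] with n h1 h2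
    exact div_pos h1 h2
  refine h1.inv_tendsto_nhdsGT_zero.congr fun n => ?_
  simp

theorem rpow_quarter_sq (n : ℕ) : ((n : ℝ) ^ (1 / 4 : ℝ)) ^ 2 = √n := by
  rw [← Real.rpow_natCast, ← Real.rpow_mul (by positivity), Real.sqrt_eq_rpow]
  norm_num

/-- The three limits serve, in order, the concentration of minimal bins, the room for the pruning
steps, and Markov's inequality. -/
theorem tendsto_rates {ψ h : ℕ → ℝ} (hψ_pos : ∀ᶠ n in atTop, 0 < ψ n)
    (hψ : (fun n : ℕ => (n : ℝ) ^ (-(1 / 4) : ℝ)) =o[atTop] ψ)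
    (hh_pos : ∀ᶠ n in atTop, 0 < h n) (hh : (fun n : ℕ => (ψ n)⁻¹) =o[atTop] h) :
    Tendsto (fun n => ψ n * (n : ℝ) ^ (1 / 4 : ℝ)) atTop atTop ∧
      Tendsto (fun n => ψ n * √(n : ℝ)) atTop atTop ∧
      Tendsto (fun n => ψ n * min (h n) √(n : ℝ)) atTop atTop := by
  have hn_pos : ∀ᶠ n : ℕ in atTop, (1 : ℝ) ≤ n := by
    filter_upwards [eventually_ge_atTop 1] with n hn
    exact_mod_cast hn
  have hylim : Tendsto (fun n => ψ n * (n : ℝ) ^ (1 / 4 : ℝ)) atTop atTop := by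
    refine (tendsto_div_atTop_of_isLittleO hψ ?_ hψ_pos).congr' ?_
    · filter_upwards [hn_pos] with n hn
      positivity
    · filter_upwards [hn_pos] with n hn
      rw [Real.rpow_neg (by positivity), div_inv_eq_mul]
  have hψh : Tendsto (fun n => ψ n * h n) atTop atTop := by
    refine (tendsto_div_atTop_of_isLittleO hh ?_ hh_pos).congr fun n => ?_
    · filter_upwards [hψ_pos] with n hn
      positivity
    · rw [div_inv_eq_mul, mul_comm]
  have hψs : Tendsto (fun n => ψ n * √(n : ℝ)) atTop atTop := by
    refine tendsto_atTop_mono' _ ?_ hylim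
    filter_upwards [hn_pos, hψ_pos] with n hn hψn
    have h1 : 1 ≤ (n : ℝ) ^ (1 / 4 : ℝ) := Real.one_le_rpow hn (by norm_num)
    rw [← rpow_quarter_sq]
    gcongr
    nlinarith
  refine ⟨hylim, hψs, ?_⟩
  have h1 : Tendsto (fun n => min (ψ n * h n) (ψ n * √(n : ℝ))) atTop atTop := by
    rw [tendsto_atTop] at hψh hψs ⊢
    intro b
    filter_upwards [hψh b, hψs b] with n h1 h2
    exact le_min h1 h2
  refine h1.congr' ?_
  filter_upwards [hψ_pos] with n hn
  rw [mul_min_of_nonneg _ _ hn.le]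

/-- The bounds for the failure probability tend to zero. -/
theorem tendsto_ofReal_bound (b : ℝ) {u : ℕ → ℝ} (hu : Tendsto u atTop atTop) :
    Tendsto (fun n : ℕ => ENNReal.ofReal (Real.exp (-√(n : ℝ)) + b * (u n)⁻¹)) atTop (𝓝 0) := by
  have h1 : Tendsto (fun n : ℕ => √(n : ℝ)) atTop atTop :=
    Real.tendsto_sqrt_atTop.comp tendsto_natCast_atTop_atTop
  have h2 : Tendsto (fun n : ℕ => Real.exp (-√(n : ℝ))) atTop (𝓝 0) :=
    Real.tendsto_exp_atBot.comp (tendsto_neg_atTop_atBot.comp h1)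
  have h3 := h2.add ((tendsto_inv_atTop_zero.comp hu).const_mul b)
  have h4 := ENNReal.tendsto_ofReal h3
  simpa using h4

/-- The gap c₁p is shared out: one half absorbs the fluctuation `η`, one quarter the slack K²w of
the pruning, and one quarter remains as δ. -/
theorem subcritical_room {K q η t c' c₁ p s N w : ℝ} (hK : 0 ≤ K) (hη : 0 ≤ η) (hc' : 0 < c')
    (hc₁ : 0 < c₁) (hp : 0 ≤ p) (hct : c' ≤ t) (hN : 0 ≤ N) (hs : 0 ≤ s) (hsN : s * s = N)
    (hηK : K ^ 2 * η ≤ c' * (c₁ * p) / 2) (hq : K * (K - 1) * q ≤ t * (1 - c₁ * p))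
    (hps : 8 * K ^ 2 / (c₁ * c') ≤ p * s) (hw : w ≤ 2 * s) :
    K * (K - 1) * (q + η) * N + K ^ 2 * w ≤ (1 - c₁ * p / 4) * (t * N) := by
  have h1 : K ^ 2 * w ≤ c₁ * p / 4 * (t * N) := by
    rw [div_le_iff₀ (by positivity)] at hps
    calc K ^ 2 * w ≤ K ^ 2 * (2 * s) := mul_le_mul_of_nonneg_left hw (sq_nonneg K)
      _ = 8 * K ^ 2 * s / 4 := by ring
      _ ≤ p * s * (c₁ * c') * s / 4 :=
          div_le_div_of_nonneg_right (mul_le_mul_of_nonneg_right hps hs) (by norm_num)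
      _ = c₁ * p / 4 * (c' * (s * s)) := by ring
      _ ≤ _ := by
          rw [hsN]
          exact mul_le_mul_of_nonneg_left (mul_le_mul_of_nonneg_right hct hN) (by positivity)
  have h2 : K * (K - 1) * (q + η) ≤ t * (1 - c₁ * p / 2) := by
    have h5 : c' * (c₁ * p) ≤ t * (c₁ * p) := mul_le_mul_of_nonneg_right hct (by positivity)
    have h6 := mul_nonneg hK hη
    calc K * (K - 1) * (q + η) = K * (K - 1) * q + K ^ 2 * η - K * η := by ring
      _ ≤ t * (1 - c₁ * p) + t * (c₁ * p) / 2 := by linarith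
      _ = _ := by ring
  have h6 := mul_le_mul_of_nonneg_right h2 hN
  linarith

end KCore

/-! ### Assembly of the main theorem -/

theorem mainTheorem4 (k : ℕ) (hk : 3 ≤ k) (m : ℕ → ℕ) (ψ : ℕ → ℝ) (C₀ : ℝ)
    (hψ_pos : ∀ᶠ n in atTop, 0 < ψ n)
    (hψ : (fun n : ℕ => (n : ℝ) ^ (-(1 / 4) : ℝ)) =o[atTop] ψ)
    (hc : ∀ᶠ n : ℕ in atTop, KCore.criticalDegree k + ψ n ≤ 2 * (m n : ℝ) / (n : ℝ) ∧
      2 * (m n : ℝ) / (n : ℝ) ≤ C₀)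
    (h : ℕ → ℝ) (hh_pos : ∀ᶠ n in atTop, 0 < h n)
    (hh : (fun n : ℕ => (ψ n)⁻¹) =o[atTop] h) :
    Tendsto (fun n : ℕ => KCore.allocationLaw k n (m n)
      {p | h n ≤ (KCore.lostVertices k (KCore.allocationGraph p.1) p.2 : ℝ)})
      atTop (𝓝 0) := by
  obtain ⟨j, rfl⟩ : ∃ j, k = j + 2 := ⟨k - 2, by omega⟩
  obtain ⟨c₁, hc₁, hsub⟩ := KCore.exists_subcritical j (by omega) C₀
  have hμ := (KCore.criticalPoint_spec hk).1
  set c' := KCore.criticalDegree (j + 2) with hc'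
  have hkc : ((j + 2 : ℕ) : ℝ) < c' := KCore.lt_truncatedMean (j + 1) hμ
  have hk0 : (0 : ℝ) < ((j + 2 : ℕ) : ℝ) := by positivity
  have hc'0 : 0 < c' := hk0.trans hkc
  obtain ⟨C, hC⟩ := KCore.exists_exp_neg_sqrt_le_totalLaw (j + 1) (B := C₀) hμ
    (sub_pos.2 hkc)
  set K : ℝ := ((j + 2 : ℕ) : ℝ) with hK
  -- The first entry keeps the fluctuation η = c₂ψ within half of the gap, the second ensures η ≤
  -- c₁ψ ≤ 1.
  set c₂ : ℝ := min (c' * c₁ / (2 * K ^ 2)) c₁ with hc₂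
  have hc₂0 : 0 < c₂ := lt_min (by positivity) hc₁
  set y : ℕ → ℝ := fun n => ψ n * (n : ℝ) ^ (1 / 4 : ℝ) with hy
  have hn_pos : ∀ᶠ n : ℕ in atTop, (1 : ℝ) ≤ n := by
    filter_upwards [eventually_ge_atTop 1] with n hn
    exact_mod_cast hn
  obtain ⟨hylim, hψs, hψh'⟩ := KCore.tendsto_rates hψ_pos hψ hh_pos hh
  have hlim := KCore.tendsto_ofReal_bound (8 / c₁) hψh'
  refine tendsto_of_tendsto_of_tendsto_of_le_of_le' tendsto_const_nhds hlim
    (Eventually.of_forall fun _ => zero_le) ?_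
  -- The extra 1 gives y ≤ y², hence c₂²y²/4 ≥ C + 1, which turns the Chernoff exponent into at most
  -- -√n.
  have hybig : ∀ᶠ n in atTop, 4 * (|C| + 1) / c₂ ^ 2 + 1 ≤ y n := hylim.eventually_ge_atTop _
  have hsbig : ∀ᶠ n in atTop, 8 * K ^ 2 / (c₁ * c') ≤ ψ n * √(n : ℝ) :=
    hψs.eventually_ge_atTop _
  filter_upwards [hn_pos, hψ_pos, hc, hh_pos, hybig, hsbig] with n hn hψn hcn hhn hyn hsn
  have hn0 : (0 : ℝ) < n := by linarith
  set t : ℝ := 2 * (m n : ℝ) / n with ht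
  have htn : 2 * (m n : ℝ) = t * n := by
    rw [ht]
    field_simp
  have hct : c' ≤ t := by linarith [hcn.1]
  obtain ⟨x, hx1, hx2, hxt, hxsub⟩ := hsub t hct hcn.2
  have hx : 0 < x := hμ.trans_le hx1
  have hs1 : 1 ≤ √(n : ℝ) := Real.one_le_sqrt.2 hn
  have hss : √(n : ℝ) * √(n : ℝ) = n := Real.mul_self_sqrt hn0.le
  have hf := KCore.expTail_pos (j + 2) hx
  have hq0 : 0 ≤ x ^ (j + 2) / ((j + 2).factorial : ℝ) / KCore.expTail (j + 2) x := by positivity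
  set q := x ^ (j + 2) / ((j + 2).factorial : ℝ) / KCore.expTail (j + 2) x with hq
  have ht0 : 0 < t := hc'0.trans_le hct
  have hgap : c₁ * ψ n ≤ c₁ * (t - c') := mul_le_mul_of_nonneg_left (by linarith [hcn.1]) hc₁.le
  -- The right side of `hxsub` bounds a nonnegative quantity and t > 0, so the gap c₁(t - c') cannot
  -- exceed 1.
  have hψ1 : c₁ * ψ n ≤ 1 := by
    have h1 : 0 ≤ (j + 2 : ℝ) * (j + 1) * q := by positivity
    have h2 : 0 ≤ 1 - c₁ * (t - c') := by
      by_contra! h3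
      nlinarith
    linarith
  set η : ℝ := c₂ * ψ n with hη
  have hη1 : η ≤ 1 := (mul_le_mul_of_nonneg_right (min_le_right _ _) hψn.le).trans hψ1
  have hηK : K ^ 2 * η ≤ c' * (c₁ * ψ n) / 2 := by
    have h1 : c₂ ≤ c' * c₁ / (2 * K ^ 2) := min_le_left _ _
    calc K ^ 2 * η ≤ K ^ 2 * (c' * c₁ / (2 * K ^ 2) * ψ n) := by
          rw [hη]
          gcongr
      _ = _ := by field_simp
  have hmin0 : 0 < min (h n) √(n : ℝ) := lt_min hhn (by linarith)
  have hCn : Real.exp (-(C * √(n : ℝ))) ≤ KCore.totalLaw (j + 2) n x (2 * m n) := by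
    refine hC n (2 * m n) x (by exact_mod_cast hn) hx1 hx2 ?_ ?_ ?_
    · have h1 : t * KCore.expTail (j + 1 + 1) x = x * KCore.expTail (j + 1) x := by
        rw [← hxt, KCore.truncatedMean]
        field_simp
      push_cast
      rw [htn, ← h1]
      ring
    · push_cast
      rw [htn]
      have : (j + 1 + 1 + (c' - (j + 1 + 1)) : ℝ) * n = c' * n := by ring
      have h2 : c' * n ≤ t * n := by gcongr
      rw [hK]
      push_cast
      linarith
    · push_cast
      rw [htn]
      gcongr
      exact hcn.2
  -- Replacing h by min(h, √n) only enlarges the event. It keeps the pruning slack of order √n,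
  -- which is small against ψn, while ψ·min(h, √n) still tends to infinity.
  have hmain := KCore.allocationLaw_lostVertices_le (k := j + 2) (n := n) (m := m n)
    (δ := c₁ * ψ n / 4) (η := η) (h := min (h n) √(n : ℝ)) (by omega) (by positivity)
    (by linarith) hx (by positivity) (by linarith) hmin0 hCn ?_
  · refine (measure_mono ?_).trans (hmain.trans (ENNReal.ofReal_le_ofReal (add_le_add ?_ ?_)))
    · intro p hp
      exact (min_le_left _ _).trans (show h n ≤ _ from hp)
    · refine Real.exp_le_exp.2 ?_
      have h1 : n * η ^ 2 = c₂ ^ 2 * (y n) ^ 2 * √(n : ℝ) := by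
        calc n * η ^ 2 = √(n : ℝ) * √(n : ℝ) * η ^ 2 := by rw [hss]
          _ = c₂ ^ 2 * (ψ n ^ 2 * ((n : ℝ) ^ (1 / 4 : ℝ)) ^ 2) * √(n : ℝ) := by
              rw [KCore.rpow_quarter_sq, hη]
              ring
          _ = _ := by rw [← mul_pow]
      have hD : 0 ≤ 4 * (|C| + 1) / c₂ ^ 2 := by positivity
      have h2 : 4 * (|C| + 1) / c₂ ^ 2 ≤ y n ^ 2 := by nlinarith
      rw [div_le_iff₀ (by positivity)] at h2
      have h3 : C + 1 ≤ c₂ ^ 2 * y n ^ 2 / 4 := by linarith [le_abs_self C]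
      rw [h1]
      have h4 := mul_le_mul_of_nonneg_right h3 (by linarith : 0 ≤ √(n : ℝ))
      linarith
    · refine le_of_eq ?_
      field_simp
      norm_num
  · rw [htn]
    refine KCore.subcritical_room hk0.le (by positivity) hc'0 hc₁ hψn.le hct hn0.le (by linarith)
      hss hηK ?_ hsn (by linarith [min_le_right (h n) √(n : ℝ)])
    have h4 : K * (K - 1) * q = (j + 2 : ℝ) * (j + 1) * q := by
      rw [hK]
      push_cast
      ring
    rw [h4]
    exact hxsub.trans (mul_le_mul_of_nonneg_left (sub_le_sub_left hgap 1) ht0.le)
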